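/- Let $d\ge 3$ and let $\mathbb D=\{x\in\mathbb R^d:\|x\|<1\}$. Let $\mathrm{Harm}_d\subset\mathbb R[x_1,\dots,x_d]$ be the space of harmonic polynomials, and let $E=\sum_i x_i\partial_i$. The Lie algebra $\mathrm{so}(d+1,1)$ acts on $\mathrm{Harm}_d$ through the operators $$P_\mu = 2x_\mu\Bigl(E+\tfrac{d-2}{2}\Bigr)-\|x\|^2\partial_\mu,\qquad K_\mu=\partial_\mu,\qquad D=E+\tfrac{d-2}{2},\qquad J_{\mu\nu}=x_\mu\partial_\nu-x_\nu\partial_\mu .$$ Let $(-,-)_H$ be the unique bilinear form on $\mathrm{Harm}_d$ with $(1,1)_H=1$ and $$(P_\mu u,v)_H=(u,K_\mu v)_H,\quad (K_\mu u,v)_H=(u,P_\mu v)_H,\quad (Du,v)_H=(u,Dv)_H,\quad (J_{\mu\nu}u,v)_H=-(u,J_{\mu\nu}v)_H$$ for all $\mu,\nu$ and all $u,v\in\mathrm{Harm}_d$; this form is symmetric and positive definite. Let $\mathcal H$ be the real Hilbert space obtained by completing $\mathrm{Harm}_d$ with respect to $(-,-)_H$, and let $\mathcal H\hat\otimes\mathcal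 H$ be the Hilbert space tensor product, i.e. the completion of the algebraic tensor product for the inner product $(v_1\otimes v_2,w_1\otimes w_2)=(v_1,w_1)(v_2,w_2)$. For $\beta\in\mathbb N^d$ write $P^\beta=\prod_\mu P_\mu^{\beta_\mu}$ and $|\beta|=\sum_i\beta_i$. Let $a,b\in\mathbb D$ and $r,s\in(0,1)$ be such that the closed balls $\overline{B_r(a)}$ and $\overline{B_s(b)}$ are disjoint and the open balls $B_r(a)$, $B_s(b)$ are contained in $\mathbb D$. Then: 1. There is exactly one linear map $C_{a,r;b,s}:\mathrm{Harm}_d\otimes\mathrm{Harm}_d\to\mathbb R$ such that for all $\beta,\gamma\in\mathbb N^d$ $$C_{a,r;b,s}(P^\beta 1\otimes P^\gamma 1)=r^{|\beta|+\frac{d-2}{2}}\,s^{|\gamma|+\frac{d-2}{2}}\,\Bigl(\partial_x^\beta\partial_y^\gamma\,\|x-y\|^{2-d}\Bigr)\Big|_{(x,y)=(a,b)} .$$ 2. There is a unique bounded linear map $\hat C_{a,r;b,s}:\mathcal H\hat\otimes\mathcal H\to\mathbb R$ whose restriction to $\mathrm{Harm}_d\otimes\mathrm{Harm}_d\subset\mathcal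 H\hat\otimes\mathcal H$ is $C_{a,r;b,s}$. -/

import Mathlib

open scoped TensorProduct

namespace HarmPoly

noncomputable section

open MvPolynomial

/-! ### Harmonic polynomials and the conformal differential operators -/

/-- Real polynomials in `d` variables. -/
abbrev Poly (d : ℕ) : Type := MvPolynomial (Fin d) ℝ

/-- The partial derivative `∂_i` as a linear map. -/
def del {d : ℕ} (i : Fin d) : Poly d →ₗ[ℝ] Poly d := (pderiv i).toLinearMap

/-- Multiplication by `x_i`. -/
def mulX {d : ℕ} (i : Fin d) : Poly d →ₗ[ℝ] Poly d := LinearMap.mulLeft ℝ (X i)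

/-- The Euler operator `E_x = ∑ x_i ∂_i`. -/
def euler (d : ℕ) : Poly d →ₗ[ℝ] Poly d := ∑ i, mulX i ∘ₗ del i

/-- Multiplication by `‖x‖² = ∑ x_i²`. -/
def mulNormSq (d : ℕ) : Poly d →ₗ[ℝ] Poly d := ∑ i, mulX i ∘ₗ mulX i

/-- The Laplacian `∑ ∂_i²`. -/
def laplacian (d : ℕ) : Poly d →ₗ[ℝ] Poly d := ∑ i, del i ∘ₗ del i

/-- The space `Harm_d` of harmonic polynomials. -/
def Harm (d : ℕ) : Submodule ℝ (Poly d) := LinearMap.ker (laplacian d)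

/-- `P_μ = 2 x_μ (E_x + (d-2)/2) - ‖x‖² ∂_μ` on polynomials. -/
def polyP {d : ℕ} (μ : Fin d) : Poly d →ₗ[ℝ] Poly d :=
  (2 : ℝ) • (mulX μ ∘ₗ (euler d + (((d : ℝ) - 2) / 2) • LinearMap.id)) - mulNormSq d ∘ₗ del μ

/-- `D = E_x + (d-2)/2` on polynomials. -/
def polyD (d : ℕ) : Poly d →ₗ[ℝ] Poly d := euler d + (((d : ℝ) - 2) / 2) • LinearMap.id

/-- `J_{μν} = x_μ ∂_ν - x_ν ∂_μ` on polynomials. -/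
def polyJ {d : ℕ} (μ ν : Fin d) : Poly d →ₗ[ℝ] Poly d := mulX μ ∘ₗ del ν - mulX ν ∘ₗ del μ

section basic

variable {d : ℕ}

lemma mulX_apply (i : Fin d) (f : Poly d) : mulX i f = X i * f := rfl

lemma del_apply (i : Fin d) (f : Poly d) : del i f = pderiv i f := rfl

lemma del_del (i j : Fin d) (f : Poly d) : del i (del j f) = del j (del i f) := by
  ext m
  simp only [del_apply, coeff_pderiv]
  by_cases h : i = j
  · subst h; rfl
  · have h' : j ≠ i := fun e => h e.symm
    simp [h, h', add_right_comm]
    ring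

lemma del_mulX (i j : Fin d) (f : Poly d) :
    del i (mulX j f) = mulX j (del i f) + if i = j then f else 0 := by
  simp only [del_apply, mulX_apply, pderiv_mul,
    pderiv_X, Pi.single_apply]
  by_cases h : i = j
  · subst h; simp; ring
  · have h' : j ≠ i := fun e => h e.symm
    simp [h, h']

lemma mulX_mulX (i j : Fin d) (f : Poly d) : mulX i (mulX j f) = mulX j (mulX i f) := by
  simp only [mulX_apply]; ring

lemma euler_apply (f : Poly d) : euler d f = ∑ i, mulX i (del i f) := by
  simp [euler]

lemma laplacian_apply (f : Poly d) : laplacian d f = ∑ i, del i (del i f) := by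
  simp [laplacian]

lemma mulNormSq_apply (f : Poly d) : mulNormSq d f = ∑ i, mulX i (mulX i f) := by
  simp [mulNormSq]

lemma mem_Harm (f : Poly d) : f ∈ Harm d ↔ laplacian d f = 0 := LinearMap.mem_ker

lemma del_euler (i : Fin d) (f : Poly d) : del i (euler d f) = euler d (del i f) + del i f := by
  simp [euler_apply, del_mulX, Finset.sum_add_distrib, del_del i]

lemma laplacian_del (i : Fin d) (f : Poly d) :
    laplacian d (del i f) = del i (laplacian d f) := by
  simp only [laplacian_apply, map_sum]
  refine Finset.sum_congr rfl fun j _ => ?_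
  rw [del_del j i, del_del j i]

lemma laplacian_mulX (i : Fin d) (f : Poly d) :
    laplacian d (mulX i f) = mulX i (laplacian d f) + (2 : ℝ) • del i f := by
  simp only [laplacian_apply, map_sum, del_mulX, map_add, Finset.sum_add_distrib]
  have h : ∀ j : Fin d, del j (if j = i then f else 0) = if j = i then del j f else 0 := by
    intro j; split_ifs <;> simp
  simp [h, two_smul, add_assoc]

lemma laplacian_euler (f : Poly d) :
    laplacian d (euler d f) = euler d (laplacian d f) + (2 : ℝ) • laplacian d f := by
  simp only [laplacian_apply, del_euler, map_add, map_sum, Finset.sum_add_distrib, two_smul,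
    add_assoc]

lemma laplacian_mulNormSq (f : Poly d) :
    laplacian d (mulNormSq d f) =
      mulNormSq d (laplacian d f) + (4 : ℝ) • euler d f + (2 * d : ℝ) • f := by
  simp only [mulNormSq_apply, map_sum, laplacian_mulX, del_mulX, map_add, map_smul, if_true,
    Finset.sum_add_distrib, euler_apply, Finset.smul_sum, smul_add, Finset.sum_const,
    Finset.card_univ, Fintype.card_fin]
  have h4 : ∀ x : Poly d, (4 : ℝ) • x = (2 : ℝ) • x + (2 : ℝ) • x := fun x => by module
  have hd : (2 * d : ℝ) • f = d • (2 : ℝ) • f := by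
    rw [mul_comm, mul_smul, Nat.cast_smul_eq_nsmul]
  simp only [h4, hd, Finset.sum_add_distrib]
  abel

lemma euler_mulX (i : Fin d) (f : Poly d) :
    euler d (mulX i f) = mulX i (euler d f) + mulX i f := by
  have h : ∀ j : Fin d, mulX j (if j = i then f else 0) = if j = i then mulX j f else 0 := by
    intro j; split_ifs <;> simp
  simp [euler_apply, del_mulX, Finset.sum_add_distrib, mulX_mulX _ i, h]

lemma polyP_apply (μ : Fin d) (f : Poly d) :
    polyP μ f = (2 : ℝ) • mulX μ (euler d f) + ((d : ℝ) - 2) • mulX μ f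
      - mulNormSq d (del μ f) := by
  simp only [polyP, LinearMap.sub_apply, LinearMap.smul_apply, LinearMap.comp_apply,
    LinearMap.add_apply, LinearMap.id_apply, map_add, map_smul]
  module

lemma del_mem (μ : Fin d) : ∀ f ∈ Harm d, del μ f ∈ Harm d := by
  intro f hf
  rw [mem_Harm] at *
  rw [laplacian_del, hf, map_zero]

lemma polyD_mem : ∀ f ∈ Harm d, polyD d f ∈ Harm d := by
  intro f hf
  rw [mem_Harm] at *
  simp [polyD, laplacian_euler, hf]

lemma polyJ_mem (μ ν : Fin d) : ∀ f ∈ Harm d, polyJ μ ν f ∈ Harm d := by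
  intro f hf
  rw [mem_Harm] at *
  simp [polyJ, laplacian_mulX, laplacian_del, hf, del_del μ ν]

lemma polyP_mem (μ : Fin d) : ∀ f ∈ Harm d, polyP μ f ∈ Harm d := by
  intro f hf
  rw [mem_Harm] at *
  simp only [polyP_apply, map_sub, map_add, map_smul, laplacian_mulX, laplacian_euler, hf,
    laplacian_mulNormSq, laplacian_del, del_euler, map_zero, smul_zero, add_zero, zero_add]
  module

lemma one_mem_Harm : (1 : Poly d) ∈ Harm d := by
  rw [mem_Harm, laplacian_apply]
  simp [del]

end basic

/-! ### The action of the conformal Lie algebra on `Harm_d` -/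

/-- The constant polynomial `1` in `Harm_d`. -/
def vac (d : ℕ) : Harm d := ⟨1, one_mem_Harm⟩

/-- The action of `P_μ` on `Harm_d`. -/
def opP {d : ℕ} (μ : Fin d) : Harm d →ₗ[ℝ] Harm d := (polyP μ).restrict (polyP_mem μ)

/-- The action of `K_μ` on `Harm_d`, which is `∂_μ`. -/
def opK {d : ℕ} (μ : Fin d) : Harm d →ₗ[ℝ] Harm d := (del μ).restrict (del_mem μ)

/-- The action of `D` on `Harm_d`. -/
def opD (d : ℕ) : Harm d →ₗ[ℝ] Harm d := (polyD d).restrict polyD_mem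

/-- The action of `J_{μν}` on `Harm_d`. -/
def opJ {d : ℕ} (μ ν : Fin d) : Harm d →ₗ[ℝ] Harm d := (polyJ μ ν).restrict (polyJ_mem μ ν)

/-- Contravariant bilinear forms on `Harm_d`, normalised by `(1, 1) = 1`: the identity
`(A u, v) = -(u, θ(A) v)` is written out for the generators of `so(d+1,1)`, with the involution
`θ(P_μ) = -K_μ`, `θ(K_μ) = -P_μ`, `θ(D) = -D`, `θ(J_{μν}) = J_{μν}`. -/
structure IsInvariantForm {d : ℕ} (B : Harm d →ₗ[ℝ] Harm d →ₗ[ℝ] ℝ) : Prop where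
  vac_vac : B (vac d) (vac d) = 1
  inv_P : ∀ (μ : Fin d) (u v : Harm d), B (opP μ u) v = B u (opK μ v)
  inv_K : ∀ (μ : Fin d) (u v : Harm d), B (opK μ u) v = B u (opP μ v)
  inv_D : ∀ u v : Harm d, B (opD d u) v = B u (opD d v)
  inv_J : ∀ (μ ν : Fin d) (u v : Harm d), B (opJ μ ν u) v = -B u (opJ μ ν v)

/-! ### Existence, uniqueness and positivity of the invariant form -/

section form

variable {d : ℕ}

/-- Auxiliary form `(x^α, x^β) = δ_{αβ} α! w(|α|)` on polynomials. -/
def wForm (d : ℕ) (w : ℕ → ℝ) : Poly d →ₗ[ℝ] Poly d →ₗ[ℝ] ℝ :=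
  (basisMonomials (Fin d) ℝ).constr ℝ fun α =>
    ((∏ i, ((α i).factorial : ℝ)) * w α.degree) • lcoeff ℝ α

lemma wForm_monomial (w : ℕ → ℝ) (α : Fin d →₀ ℕ) (c : ℝ) (g : Poly d) :
    wForm d w (monomial α c) g = c * ((∏ i, ((α i).factorial : ℝ)) * w α.degree) * coeff α g := by
  have h : (monomial α c : Poly d) = c • (basisMonomials (Fin d) ℝ α) := by
    simp [smul_monomial]
  rw [h, map_smul, wForm, Module.Basis.constr_basis]
  simp [mul_assoc]

lemma wForm_apply (w : ℕ → ℝ) (f g : Poly d) :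
    wForm d w f g = ∑ α ∈ f.support,
      coeff α f * ((∏ i, ((α i).factorial : ℝ)) * w α.degree) * coeff α g := by
  conv_lhs => rw [f.as_sum]
  simp only [map_sum, LinearMap.sum_apply, wForm_monomial]

lemma wForm_symm (w : ℕ → ℝ) (f g : Poly d) : wForm d w f g = wForm d w g f := by
  induction f using MvPolynomial.induction_on' with
  | add p q hp hq => simp [hp, hq]
  | monomial α a =>
    induction g using MvPolynomial.induction_on' with
    | add p q hp hq => simp [hp, hq]
    | monomial β b =>
      simp only [wForm_monomial, coeff_monomial]
      by_cases h : α = β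
      · subst h; simp; ring
      · have h' : β ≠ α := fun e => h e.symm
        simp only [if_neg h, if_neg h', mul_zero]

lemma wForm_mulX (w : ℕ → ℝ) (i : Fin d) (f g : Poly d) :
    wForm d w (mulX i f) g = wForm d (fun n => w (n + 1)) f (del i g) := by
  induction f using MvPolynomial.induction_on' with
  | add p q hp hq => simp [hp, hq]
  | monomial α a =>
    have h : (mulX i (monomial α a) : Poly d) = monomial (α + Finsupp.single i 1) a := by
      rw [mulX_apply, X, monomial_mul, one_mul, add_comm]
    have hf : (∏ j, (((α + Finsupp.single i 1 : Fin d →₀ ℕ) j).factorial : ℝ))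
        = (α i + 1) * ∏ j, ((α j).factorial : ℝ) := by
      rw [← Finset.mul_prod_erase _ _ (Finset.mem_univ i),
        ← Finset.mul_prod_erase _ (fun j => ((α j).factorial : ℝ)) (Finset.mem_univ i)]
      have : ∀ j ∈ Finset.univ.erase i,
          (((α + Finsupp.single i 1 : Fin d →₀ ℕ) j).factorial : ℝ) = ((α j).factorial : ℝ) := by
        intro j hj
        simp [(Finset.ne_of_mem_erase hj).symm]
      rw [Finset.prod_congr rfl this]
      simp [Nat.factorial_succ]
      ring
    rw [h, wForm_monomial, wForm_monomial, hf]
    simp only [del_apply, coeff_pderiv, map_add,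
      Finsupp.degree_single]
    ring

lemma wForm_del (w : ℕ → ℝ) (i : Fin d) (f g : Poly d) :
    wForm d (fun n => w (n + 1)) (del i f) g = wForm d w f (mulX i g) := by
  rw [wForm_symm, ← wForm_mulX, wForm_symm]

lemma euler_monomial (α : Fin d →₀ ℕ) (a : ℝ) :
    euler d (monomial α a) = (α.degree : ℝ) • monomial α a := by
  have h : ∀ i : Fin d, mulX i (del i (monomial α a)) = (α i : ℝ) • monomial α a := by
    intro i
    simp only [del_apply, mulX_apply]
    rw [X_mul_pderiv_monomial, Nat.cast_smul_eq_nsmul]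
  simp only [euler_apply, h, ← Finset.sum_smul]
  rw [Finsupp.degree_eq_sum, Nat.cast_sum]

lemma wForm_euler (w : ℕ → ℝ) (f g : Poly d) :
    wForm d w (euler d f) g = wForm d (fun n => n * w n) f g := by
  induction f using MvPolynomial.induction_on' with
  | add p q hp hq => simp [hp, hq]
  | monomial α a =>
    rw [euler_monomial, map_smul, LinearMap.smul_apply, wForm_monomial, wForm_monomial,
      smul_eq_mul]
    ring

lemma wForm_comb (w₁ w₂ : ℕ → ℝ) (c₁ c₂ : ℝ) (f g : Poly d) :
    c₁ * wForm d w₁ f g + c₂ * wForm d w₂ f g = wForm d (fun n => c₁ * w₁ n + c₂ * w₂ n) f g := by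
  simp only [wForm_apply, Finset.mul_sum, ← Finset.sum_add_distrib]
  refine Finset.sum_congr rfl fun α _ => ?_
  ring

/-- The weight `1 / (2^n ((d-2)/2)_n) = 1 / ((d-2) d (d+2) ⋯ (d-2+2(n-1)))`. -/
def fischerWeight (d n : ℕ) : ℝ := (∏ k ∈ Finset.range n, ((d : ℝ) - 2 + 2 * k))⁻¹

lemma fischerWeight_pos (hd : 3 ≤ d) (n : ℕ) : 0 < fischerWeight d n := by
  have hd' : (3 : ℝ) ≤ d := by exact_mod_cast hd
  refine inv_pos.2 (Finset.prod_pos fun k _ => ?_)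
  have : (0 : ℝ) ≤ k := Nat.cast_nonneg k
  linarith

lemma fischerWeight_succ (hd : 3 ≤ d) (n : ℕ) :
    (2 * n + (d - 2) : ℝ) * fischerWeight d (n + 1) = fischerWeight d n := by
  have hd' : (3 : ℝ) ≤ d := by exact_mod_cast hd
  have hn : (0 : ℝ) ≤ n := Nat.cast_nonneg n
  have h : ((d : ℝ) - 2 + 2 * n) ≠ 0 := ne_of_gt (by linarith)
  rw [fischerWeight, fischerWeight, Finset.prod_range_succ, mul_inv]
  field_simp
  ring

/-- The normalised form `(x^α, x^β) = δ_{αβ} α! / (2^|α| ((d-2)/2)_{|α|})` on polynomials. -/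
def fischerForm (d : ℕ) : Poly d →ₗ[ℝ] Poly d →ₗ[ℝ] ℝ := wForm d (fischerWeight d)

lemma fischerForm_mulX (hd : 3 ≤ d) (μ : Fin d) (f g : Poly d) :
    fischerForm d ((2 : ℝ) • mulX μ (euler d f) + ((d : ℝ) - 2) • mulX μ f) g
      = fischerForm d f (del μ g) := by
  simp only [fischerForm, map_add, map_smul, LinearMap.add_apply, LinearMap.smul_apply,
    wForm_mulX, wForm_euler, smul_eq_mul, wForm_comb]
  congr 3
  funext n
  rw [← fischerWeight_succ hd n]
  ring

lemma wForm_mulNormSq (w : ℕ → ℝ) (f g : Poly d) (hg : g ∈ Harm d) :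
    wForm d w (mulNormSq d f) g = 0 := by
  rw [mem_Harm, laplacian_apply] at hg
  simp only [mulNormSq_apply, map_sum, LinearMap.sum_apply, wForm_mulX]
  rw [← map_sum, hg, map_zero]

lemma fischerForm_polyP (hd : 3 ≤ d) (μ : Fin d) (f g : Poly d) (hg : g ∈ Harm d) :
    fischerForm d (polyP μ f) g = fischerForm d f (del μ g) := by
  rw [polyP_apply, map_sub, LinearMap.sub_apply, fischerForm_mulX hd, fischerForm,
    wForm_mulNormSq _ _ _ hg, sub_zero]

lemma fischerForm_symm (f g : Poly d) : fischerForm d f g = fischerForm d g f := wForm_symm _ _ _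

/-- The restriction of `fischerForm` to harmonic polynomials. -/
def fischerHarm (d : ℕ) : Harm d →ₗ[ℝ] Harm d →ₗ[ℝ] ℝ :=
  (fischerForm d).compl₁₂ (Harm d).subtype (Harm d).subtype

lemma fischerHarm_apply (u v : Harm d) :
    fischerHarm d u v = fischerForm d (u : Poly d) (v : Poly d) := rfl

lemma fischerHarm_invariant (hd : 3 ≤ d) : IsInvariantForm (fischerHarm d) where
  vac_vac := by
    have h : (1 : Poly d) = monomial 0 1 := rfl
    simp only [fischerHarm_apply, vac, fischerForm, h, wForm_monomial]
    simp [fischerWeight]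
  inv_P μ u v := fischerForm_polyP hd μ u v v.2
  inv_K μ u v := by
    rw [fischerHarm_apply, fischerHarm_apply, fischerForm_symm, fischerForm_symm (u : Poly d)]
    exact (fischerForm_polyP hd μ v u u.2).symm
  inv_D u v := by
    have h : fischerForm d (euler d (u : Poly d)) v = fischerForm d u (euler d (v : Poly d)) := by
      rw [fischerForm_symm (u : Poly d)]
      simp only [fischerForm, wForm_euler]
      exact wForm_symm _ _ _
    simp [fischerHarm_apply, opD, polyD, h]
  inv_J μ ν u v := by
    have h : ∀ i j : Fin d, fischerForm d (mulX i (del j (u : Poly d))) v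
        = fischerForm d u (mulX j (del i (v : Poly d))) := by
      intro i j
      rw [fischerForm_symm (u : Poly d)]
      simp only [fischerForm, wForm_mulX]
      exact wForm_symm _ _ _
    simp [fischerHarm_apply, opJ, polyJ, h]

lemma fischerHarm_self (u : Harm d) : fischerHarm d u u = ∑ α ∈ (u : Poly d).support,
    ((∏ i, ((α i).factorial : ℝ)) * fischerWeight d α.degree) * coeff α (u : Poly d) ^ 2 := by
  rw [fischerHarm_apply, fischerForm, wForm_apply]
  refine Finset.sum_congr rfl fun α _ => ?_
  ring

lemma fischerHarm_nonneg (hd : 3 ≤ d) (u : Harm d) : 0 ≤ fischerHarm d u u := by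
  rw [fischerHarm_self]
  refine Finset.sum_nonneg fun α _ => ?_
  have := fischerWeight_pos hd α.degree
  positivity

lemma fischerHarm_definite (hd : 3 ≤ d) (u : Harm d) (h : fischerHarm d u u = 0) : u = 0 := by
  by_contra hu
  have hu' : (u : Poly d) ≠ 0 := fun e => hu (Subtype.ext e)
  refine absurd h (ne_of_gt ?_)
  rw [fischerHarm_self]
  refine Finset.sum_pos (fun α hα => ?_) (by simpa [Finset.nonempty_iff_ne_empty] using hu')
  have h1 := fischerWeight_pos hd α.degree
  have h2 := mem_support_iff.1 hα
  positivity

lemma comp_mem (n : ℕ) : ∀ f ∈ Harm d, homogeneousComponent n f ∈ Harm d := by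
  intro f hf
  rw [mem_Harm] at *
  ext m
  have h : ∀ g : Poly d, coeff m (laplacian d g) =
      ∑ i, coeff (m + Finsupp.single i 1 + Finsupp.single i 1) g * (m i + 2) * (m i + 1) := by
    intro g
    rw [laplacian_apply, coeff_sum]
    refine Finset.sum_congr rfl fun i _ => ?_
    simp only [del_apply, coeff_pderiv]
    simp only [Finsupp.coe_add, Pi.add_apply, Finsupp.single_eq_same]
    push_cast
    ring
  have h0 := h f
  rw [hf, coeff_zero] at h0
  rw [h, coeff_zero]
  simp only [coeff_homogeneousComponent, map_add, Finsupp.degree_single]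
  split_ifs
  · exact h0.symm
  · simp

/-- The homogeneous component of degree `n` of a harmonic polynomial. -/
def comp (n : ℕ) : Harm d →ₗ[ℝ] Harm d := (homogeneousComponent n).restrict (comp_mem n)

lemma sum_comp (u : Harm d) : ∑ n ∈ Finset.range ((u : Poly d).totalDegree + 1), comp n u = u := by
  apply Subtype.ext
  rw [AddSubmonoidClass.coe_finsetSum]
  exact MvPolynomial.sum_homogeneousComponent (u : Poly d)

lemma euler_comp (n : ℕ) (u : Harm d) :
    euler d (comp n u : Harm d) = (n : ℝ) • (comp n u : Poly d) := by
  have h := (homogeneousComponent_isHomogeneous n (u : Poly d)).sum_X_mul_pderiv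
  rw [euler_apply, Nat.cast_smul_eq_nsmul]
  exact h

lemma sum_opP_opK (n : ℕ) (u : Harm d) :
    ∑ i, opP i (opK i (comp n u)) = ((n : ℝ) * (2 * n + d - 4)) • comp n u := by
  apply Subtype.ext
  rw [AddSubmonoidClass.coe_finsetSum]
  have hu := (comp n u).2
  have he := euler_comp n u
  have h1 : ∀ i : Fin d, ((opP i (opK i (comp n u)) : Harm d) : Poly d) =
      polyP i (del i (comp n u : Poly d)) := fun i => rfl
  rw [Submodule.coe_smul]
  generalize (comp n u : Poly d) = f at *
  rw [mem_Harm, laplacian_apply] at hu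
  have h2 : ∀ i : Fin d, euler d (del i f) = ((n : ℝ) - 1) • del i f := by
    intro i
    have := del_euler i f
    rw [he, map_smul] at this
    rw [sub_smul, one_smul, this]
    abel
  simp only [h1, polyP_apply, h2, map_smul, Finset.sum_sub_distrib, Finset.sum_add_distrib,
    ← Finset.smul_sum, ← euler_apply, ← map_sum, hu, map_zero, he]
  module

lemma comp_zero (u : Harm d) : ∃ c : ℝ, comp 0 u = c • vac d := by
  refine ⟨coeff 0 (u : Poly d), Subtype.ext ?_⟩
  change homogeneousComponent 0 (u : Poly d) = coeff 0 (u : Poly d) • (1 : Poly d)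
  rw [homogeneousComponent_zero, MvPolynomial.smul_eq_C_mul, mul_one]

lemma comp_of_homogeneous (n : ℕ) (u : Harm d) (h : (u : Poly d).IsHomogeneous n) :
    comp n u = u := by
  apply Subtype.ext
  change homogeneousComponent n (u : Poly d) = u
  rw [homogeneousComponent_of_mem h, if_pos rfl]

lemma opK_comp (n : ℕ) (i : Fin d) (u : Harm d) :
    comp n (opK i (comp (n + 1) u)) = opK i (comp (n + 1) u) := by
  apply comp_of_homogeneous
  exact (homogeneousComponent_isHomogeneous (n + 1) (u : Poly d)).pderiv

lemma factor_ne (hd : 3 ≤ d) (n : ℕ) : ((n + 1 : ℕ) : ℝ) * (2 * (n + 1 : ℕ) + d - 4) ≠ 0 := by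
  have hd' : (3 : ℝ) ≤ d := by exact_mod_cast hd
  have hn : (0 : ℝ) ≤ n := Nat.cast_nonneg n
  refine mul_ne_zero (by positivity) (ne_of_gt ?_)
  push_cast
  linarith

lemma opK_vac (i : Fin d) : opK i (vac d) = 0 := by
  apply Subtype.ext
  change pderiv i (1 : Poly d) = 0
  simp

lemma invariantForm_unique (hd : 3 ≤ d) {B B' : Harm d →ₗ[ℝ] Harm d →ₗ[ℝ] ℝ}
    (hB : IsInvariantForm B) (hB' : IsInvariantForm B') : B = B' := by
  have hvac : ∀ (n : ℕ) (v : Harm d), B (vac d) (comp n v) = B' (vac d) (comp n v) := by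
    intro n v
    cases n with
    | zero =>
      obtain ⟨c, hc⟩ := comp_zero v
      rw [hc, map_smul, map_smul, hB.vac_vac, hB'.vac_vac]
    | succ n =>
      have h := sum_opP_opK (n + 1) v
      have e : ∀ A : Harm d →ₗ[ℝ] Harm d →ₗ[ℝ] ℝ, IsInvariantForm A →
          A (vac d) (comp (n + 1) v) = 0 := by
        intro A hA
        have := congrArg (A (vac d)) h
        simp only [map_sum, ← hA.inv_K, opK_vac, map_zero, LinearMap.zero_apply,
          Finset.sum_const_zero, map_smul, smul_eq_mul] at this
        exact (mul_eq_zero.1 this.symm).resolve_left (factor_ne hd n)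
      rw [e B hB, e B' hB']
  have hvac' : ∀ v : Harm d, B (vac d) v = B' (vac d) v := by
    intro v
    rw [← sum_comp v, map_sum, map_sum]
    exact Finset.sum_congr rfl fun n _ => hvac n v
  have key : ∀ (n : ℕ) (u v : Harm d), B (comp n u) v = B' (comp n u) v := by
    intro n
    induction n with
    | zero =>
      intro u v
      obtain ⟨c, hc⟩ := comp_zero u
      simp [hc, hvac']
    | succ n ih =>
      intro u v
      have h := sum_opP_opK (n + 1) u
      have e : ∀ A : Harm d →ₗ[ℝ] Harm d →ₗ[ℝ] ℝ, IsInvariantForm A →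
          ((n + 1 : ℕ) : ℝ) * (2 * (n + 1 : ℕ) + d - 4) * A (comp (n + 1) u) v
            = ∑ i, A (opK i (comp (n + 1) u)) (opK i v) := by
        intro A hA
        have := congrArg (fun x => A x v) h
        simp only [map_sum, LinearMap.sum_apply, hA.inv_P, map_smul, LinearMap.smul_apply,
          smul_eq_mul] at this
        exact this.symm
      refine mul_left_cancel₀ (factor_ne hd n) ?_
      rw [e B hB, e B' hB']
      refine Finset.sum_congr rfl fun i _ => ?_
      rw [← opK_comp n i u, ih]
  ext u v
  rw [← sum_comp u]
  simp only [map_sum, LinearMap.sum_apply]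
  exact Finset.sum_congr rfl fun n _ => key n u v

lemma existsUnique_invariantForm (hd : 3 ≤ d) :
    ∃! B : Harm d →ₗ[ℝ] Harm d →ₗ[ℝ] ℝ, IsInvariantForm B :=
  ⟨fischerHarm d, fischerHarm_invariant hd,
    fun _ h => invariantForm_unique hd h (fischerHarm_invariant hd)⟩

end form

/-! ### The Hilbert space `ℋ` and its Hilbert tensor square -/

section hilbert

variable (d : ℕ) [hd : Fact (3 ≤ d)]

/-- The inner product `(-,-)_H` on `Harm_d`: the unique normalised contravariant form. -/
def harmForm : Harm d →ₗ[ℝ] Harm d →ₗ[ℝ] ℝ := (existsUnique_invariantForm hd.out).choose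

lemma harmForm_invariant : IsInvariantForm (harmForm d) :=
  (existsUnique_invariantForm hd.out).choose_spec.1

lemma harmForm_eq : harmForm d = fischerHarm d :=
  invariantForm_unique hd.out (harmForm_invariant d) (fischerHarm_invariant hd.out)

/-- A copy of `Harm_d` that carries the inner product `(-,-)_H`. -/
def PreHilbert (d : ℕ) : Type := Harm d

instance : AddCommGroup (PreHilbert d) := inferInstanceAs (AddCommGroup (Harm d))

instance : Module ℝ (PreHilbert d) := inferInstanceAs (Module ℝ (Harm d))

/-- The identity map from `Harm_d` to its copy with inner product. -/
def toPreHilbert (d : ℕ) : Harm d ≃ₗ[ℝ] PreHilbert d := LinearEquiv.refl ℝ (Harm d)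

/-- `(-,-)_H` is a positive definite inner product. -/
abbrev harmCore : InnerProductSpace.Core ℝ (PreHilbert d) where
  inner u v := harmForm d ((toPreHilbert d).symm u) ((toPreHilbert d).symm v)
  conj_inner_symm u v := by
    rw [harmForm_eq]
    exact fischerForm_symm _ _
  re_inner_nonneg u := by
    rw [harmForm_eq]
    exact fischerHarm_nonneg hd.out _
  add_left u v w := by simp
  smul_left u v c := by simp
  definite u h := by
    rw [harmForm_eq] at h
    exact fischerHarm_definite hd.out u h

instance : NormedAddCommGroup (PreHilbert d) :=
  @InnerProductSpace.Core.toNormedAddCommGroup ℝ (PreHilbert d) _ _ _ (harmCore d)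

instance : InnerProductSpace ℝ (PreHilbert d) := InnerProductSpace.ofCore (harmCore d).toCore

lemma inner_toPreHilbert (u v : Harm d) :
    inner ℝ (toPreHilbert d u) (toPreHilbert d v) = harmForm d u v := rfl

/-- The real Hilbert space `ℋ`, the completion of `Harm_d` with respect to `(-,-)_H`. -/
abbrev HarmHilbert : Type := UniformSpace.Completion (PreHilbert d)

/-- The inclusion `Harm_d → ℋ`. -/
def harmIncl : Harm d →ₗ[ℝ] HarmHilbert d :=
  (UniformSpace.Completion.toComplL (𝕜 := ℝ) (E := PreHilbert d)).toLinearMap ∘ₗ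
    (toPreHilbert d).toLinearMap

/-- The Hilbert space tensor product `ℋ ⊗̂ ℋ`: the completion of the algebraic tensor product
for the inner product with `⟪v₁ ⊗ v₂, w₁ ⊗ w₂⟫ = ⟪v₁, w₁⟫ ⟪v₂, w₂⟫`. -/
abbrev HilbertSquare : Type := UniformSpace.Completion (HarmHilbert d ⊗[ℝ] HarmHilbert d)

/-- The inclusion `Harm_d ⊗ Harm_d → ℋ ⊗̂ ℋ`. -/
def tensorIncl : (Harm d ⊗[ℝ] Harm d) →ₗ[ℝ] HilbertSquare d :=
  (UniformSpace.Completion.toComplL (𝕜 := ℝ)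
      (E := HarmHilbert d ⊗[ℝ] HarmHilbert d)).toLinearMap ∘ₗ
    TensorProduct.map (harmIncl d) (harmIncl d)

end hilbert

/-! ### The contraction -/

/-- `P^β = ∏ P_μ^{β_μ}` acting on `Harm_d` (the operators `P_μ` commute). -/
def opPPow {d : ℕ} (β : Fin d → ℕ) : Harm d →ₗ[ℝ] Harm d :=
  ((List.finRange d).map fun μ => opP μ ^ β μ).prod

/-- The partial derivative `∂_i F` of a function on `ℝ^d`. -/
def partialDeriv {d : ℕ} (i : Fin d) (F : EuclideanSpace ℝ (Fin d) → ℝ) :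
    EuclideanSpace ℝ (Fin d) → ℝ :=
  fun x => fderiv ℝ F x (EuclideanSpace.single i 1)

/-- The iterated partial derivative `∂^β F = ∂_1^{β_1} ⋯ ∂_d^{β_d} F`. -/
def multiDeriv {d : ℕ} (β : Fin d → ℕ) (F : EuclideanSpace ℝ (Fin d) → ℝ) :
    EuclideanSpace ℝ (Fin d) → ℝ :=
  (List.finRange d).foldr (fun i G => (partialDeriv i)^[β i] G) F

/-- `∂_x^β ∂_y^γ ‖x - y‖^{2-d}` evaluated at `(x, y) = (a, b)`. -/
def greenDeriv {d : ℕ} (β γ : Fin d → ℕ) (a b : EuclideanSpace ℝ (Fin d)) : ℝ :=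
  multiDeriv β (fun x => multiDeriv γ (fun y => 1 / ‖x - y‖ ^ (d - 2)) b) a

/-- The defining property of the contraction `C_{a,r;b,s}`:
`C(P^β.1, P^γ.1) = r^{|β|+(d-2)/2} s^{|γ|+(d-2)/2} ∂_x^β ∂_y^γ ‖x-y‖^{2-d}` at `(a, b)`. -/
def IsContraction {d : ℕ} (a : EuclideanSpace ℝ (Fin d)) (r : ℝ) (b : EuclideanSpace ℝ (Fin d))
    (s : ℝ) (C : (Harm d ⊗[ℝ] Harm d) →ₗ[ℝ] ℝ) : Prop :=
  ∀ β γ : Fin d → ℕ, C (opPPow β (vac d) ⊗ₜ[ℝ] opPPow γ (vac d)) =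
    r ^ ((∑ i, (β i : ℝ)) + ((d : ℝ) - 2) / 2) * s ^ ((∑ i, (γ i : ℝ)) + ((d : ℝ) - 2) / 2) *
      greenDeriv β γ a b

end

end HarmPoly

namespace HarmPoly

noncomputable section

open MvPolynomial
open scoped ContDiff

/-! ### Iterated partial derivatives of smooth functions -/

section partialDerivatives

variable {d : ℕ} {U : Set (EuclideanSpace ℝ (Fin d))} {f g : EuclideanSpace ℝ (Fin d) → ℝ}

/-! Write `w` for `fischerWeight d`. The invariant form is the restriction to harmonic polynomials
of a form on all polynomials for which monomials are orthogonal, with `(x^α, x^α) = α! w(|α|)`. So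
both the contraction and the norm can be computed from monomial coefficients, and no basis of
spherical harmonics is needed.

Existence. For a family `φ` of values, let `x^α` go to `w(|α|) φ(α)`. If `∑ᵢ φ(α + 2eᵢ) = 0` for all
`α`, this map kills multiples of `‖x‖²`, so that `P_μ` becomes the shift `φ ↦ φ(· + e_μ)` and `P^β
1` goes to `φ(β)` (`weightedEval_polyP`, `weightedEval_opPPow_vac`). With `G = ‖x‖^{2-d}`, the
required values are powers of `r` and `s` times `(-1)^|γ| ∂^{β+γ} G(a - b)`. The condition on `φ` in
each slot is harmonicity of `G`. Uniqueness holds because the vectors `P^β 1` span `Harm_d`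
(`span_opPPow_vac`).

Boundedness. By Cauchy–Schwarz in monomial coefficients, it suffices that the sum of `w(|β|) w(|γ|)
φ(β,γ)² / (β! γ!)` is finite. For fixed degrees `n`, `m`, the multinomial formula reduces this sum
to the sum of squares of all derivatives of `G` of order `n + m`. That quantity has a closed form
(`derivSqSum_invNormPow`): for harmonic `f`, the Laplacian of the order-`n` sum is twice the
order-`(n+1)` sum, and the Laplacian of a power of `‖x‖` is again a power. Up to polynomial factors,
the contribution of `(n, m)` is at most `((r + s)/‖a - b‖)^{2(n+m)}` (`weights_mul_pow_le`).
Disjointness of the closed balls says exactly that this ratio is below 1, so the double sum is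
finite. The bounded functional then extends uniquely, since `Harm_d ⊗ Harm_d` is isometric to a
dense subspace of the Hilbert tensor square. -/

lemma contDiffOn_partialDeriv (hU : IsOpen U) (hf : ContDiffOn ℝ ∞ f U) (i : Fin d) :
    ContDiffOn ℝ ∞ (partialDeriv i f) U :=
  (hf.fderiv_of_isOpen hU (by simp)).clm_apply contDiffOn_const

lemma contDiffOn_iterate_partialDeriv (hU : IsOpen U) (hf : ContDiffOn ℝ ∞ f U) (i : Fin d)
    (k : ℕ) : ContDiffOn ℝ ∞ ((partialDeriv i)^[k] f) U := by
  induction k with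
  | zero => exact hf
  | succ k ih => rw [Function.iterate_succ_apply']; exact contDiffOn_partialDeriv hU ih i

lemma contDiffOn_foldr_partialDeriv (hU : IsOpen U) (hf : ContDiffOn ℝ ∞ f U) (β : Fin d → ℕ)
    (l : List (Fin d)) :
    ContDiffOn ℝ ∞ (l.foldr (fun i G => (partialDeriv i)^[β i] G) f) U := by
  induction l with
  | nil => exact hf
  | cons i l ih => exact contDiffOn_iterate_partialDeriv hU ih i _

lemma contDiffOn_multiDeriv (hU : IsOpen U) (hf : ContDiffOn ℝ ∞ f U) (β : Fin d → ℕ) :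
    ContDiffOn ℝ ∞ (multiDeriv β f) U :=
  contDiffOn_foldr_partialDeriv hU hf β _

lemma eqOn_partialDeriv (hU : IsOpen U) (h : Set.EqOn f g U) (i : Fin d) :
    Set.EqOn (partialDeriv i f) (partialDeriv i g) U := fun x hx => by
  simp only [partialDeriv, (h.eventuallyEq_of_mem (hU.mem_nhds hx)).fderiv_eq]

lemma eqOn_iterate_partialDeriv (hU : IsOpen U) (h : Set.EqOn f g U) (i : Fin d) (k : ℕ) :
    Set.EqOn ((partialDeriv i)^[k] f) ((partialDeriv i)^[k] g) U := by
  induction k with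
  | zero => exact h
  | succ k ih => simpa only [Function.iterate_succ_apply'] using eqOn_partialDeriv hU ih i

lemma differentiableAt_of_contDiffOn (hU : IsOpen U) (hf : ContDiffOn ℝ ∞ f U)
    {x : EuclideanSpace ℝ (Fin d)} (hx : x ∈ U) : DifferentiableAt ℝ f x :=
  (hf.contDiffAt (hU.mem_nhds hx)).differentiableAt (by simp)

lemma partialDeriv_comm (hU : IsOpen U) (hf : ContDiffOn ℝ ∞ f U) (i j : Fin d) :
    Set.EqOn (partialDeriv i (partialDeriv j f)) (partialDeriv j (partialDeriv i f)) U := by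
  intro x hx
  have hsymm : IsSymmSndFDerivAt ℝ f x :=
    (hf.contDiffAt (hU.mem_nhds hx)).isSymmSndFDerivAt
      (by simpa using WithTop.coe_le_coe.2 (le_top : (2 : ℕ∞) ≤ ⊤))
  have hd : DifferentiableAt ℝ (fderiv ℝ f) x :=
    ((hf.fderiv_of_isOpen (m := ∞) hU (by simp)).contDiffAt (hU.mem_nhds hx)).differentiableAt
      (by simp)
  have key : ∀ v w : EuclideanSpace ℝ (Fin d),
      fderiv ℝ (fun y => fderiv ℝ f y v) x w = fderiv ℝ (fderiv ℝ f) x w v := fun v w => by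
    rw [fderiv_clm_apply hd (differentiableAt_const v)]
    simp
  change fderiv ℝ (fun y => fderiv ℝ f y _) x _ = fderiv ℝ (fun y => fderiv ℝ f y _) x _
  rw [key, key]
  exact hsymm _ _

lemma iterate_partialDeriv_comm (hU : IsOpen U) (hf : ContDiffOn ℝ ∞ f U) (i j : Fin d) (k : ℕ) :
    Set.EqOn ((partialDeriv i)^[k] (partialDeriv j f)) (partialDeriv j ((partialDeriv i)^[k] f))
      U := by
  induction k with
  | zero => exact fun _ _ => rfl
  | succ k ih =>
    simp only [Function.iterate_succ_apply']
    exact (eqOn_partialDeriv hU ih i).trans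
      (partialDeriv_comm hU (contDiffOn_iterate_partialDeriv hU hf i k) i j)

lemma partialDeriv_mul (hf : ContDiffOn ℝ ∞ f U) (hg : ContDiffOn ℝ ∞ g U) (hU : IsOpen U)
    (i : Fin d) : Set.EqOn (partialDeriv i (fun x => f x * g x))
      (fun x => f x * partialDeriv i g x + g x * partialDeriv i f x) U := by
  intro x hx
  simp only [partialDeriv]
  rw [fderiv_fun_mul (differentiableAt_of_contDiffOn hU hf hx)
    (differentiableAt_of_contDiffOn hU hg hx)]
  simp

lemma partialDeriv_sum {ι : Type*} (s : Finset ι) {F : ι → EuclideanSpace ℝ (Fin d) → ℝ}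
    (hF : ∀ k ∈ s, ContDiffOn ℝ ∞ (F k) U) (hU : IsOpen U) (i : Fin d) :
    Set.EqOn (partialDeriv i (fun x => ∑ k ∈ s, F k x)) (fun x => ∑ k ∈ s, partialDeriv i (F k) x)
      U := by
  intro x hx
  simp only [partialDeriv]
  rw [fderiv_fun_sum fun k hk => differentiableAt_of_contDiffOn hU (hF k hk) hx]
  simp

lemma foldr_partialDeriv_congr {β γ : Fin d → ℕ} (l : List (Fin d)) (h : ∀ i ∈ l, β i = γ i) :
    l.foldr (fun i G => (partialDeriv i)^[β i] G) f =
      l.foldr (fun i G => (partialDeriv i)^[γ i] G) f := by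
  induction l with
  | nil => rfl
  | cons i l ih =>
    simp only [List.foldr_cons, h i (by simp), ih fun j hj => h j (by simp [hj])]

/-- `multiDeriv` fixes an order of differentiation, so the extra derivative has to be moved outwards
past the others. Symmetry of second derivatives permits this, but only on the open set where `f` is
smooth; hence `EqOn` throughout. -/
lemma foldr_partialDeriv_add_single (hU : IsOpen U) (hf : ContDiffOn ℝ ∞ f U) (β : Fin d → ℕ)
    (i : Fin d) (l : List (Fin d)) (hl : l.Nodup) (hi : i ∈ l) :
    Set.EqOn (l.foldr (fun j G => (partialDeriv j)^[(β + Pi.single i 1 : Fin d → ℕ) j] G) f)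
      (partialDeriv i (l.foldr (fun j G => (partialDeriv j)^[β j] G) f)) U := by
  induction l with
  | nil => simp at hi
  | cons j l ih =>
    obtain ⟨hj, hl'⟩ := List.nodup_cons.1 hl
    simp only [List.foldr_cons]
    by_cases hij : i = j
    · subst hij
      rw [foldr_partialDeriv_congr (β := β + Pi.single i 1) (γ := β) l fun k hk => by
        have : k ≠ i := fun e => hj (e ▸ hk)
        simp [this]]
      simp only [Pi.add_apply, Pi.single_eq_same, Function.iterate_succ_apply']
      exact fun _ _ => rfl
    · have hi' : i ∈ l := (List.mem_cons.1 hi).resolve_left hij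
      have hji : j ≠ i := fun e => hij e.symm
      simp only [Pi.add_apply, Pi.single_eq_of_ne hji, add_zero]
      exact (eqOn_iterate_partialDeriv hU (ih hl' hi') j _).trans
        (iterate_partialDeriv_comm hU (contDiffOn_foldr_partialDeriv hU hf β l) j i _)

lemma multiDeriv_zero : multiDeriv (0 : Fin d → ℕ) f = f := by
  unfold multiDeriv
  induction List.finRange d with
  | nil => rfl
  | cons i l ih => simp

lemma multiDeriv_add_single (hU : IsOpen U) (hf : ContDiffOn ℝ ∞ f U) (β : Fin d → ℕ)
    (i : Fin d) : Set.EqOn (multiDeriv (β + Pi.single i 1) f) (partialDeriv i (multiDeriv β f)) U :=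
  foldr_partialDeriv_add_single hU hf β i _ (List.nodup_finRange d) (List.mem_finRange i)

lemma iterate_partialDeriv_multiDeriv (hU : IsOpen U) (hf : ContDiffOn ℝ ∞ f U) (β : Fin d → ℕ)
    (i : Fin d) (k : ℕ) :
    Set.EqOn ((partialDeriv i)^[k] (multiDeriv β f)) (multiDeriv (β + Pi.single i k) f) U := by
  induction k with
  | zero => simpa using Set.eqOn_refl _ _
  | succ k ih =>
    rw [Function.iterate_succ_apply', Pi.single_add, ← add_assoc]
    exact (eqOn_partialDeriv hU ih i).trans (multiDeriv_add_single hU hf _ i).symm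

lemma sum_finRange_single (β : Fin d → ℕ) :
    ((List.finRange d).map fun i => (Pi.single i (β i) : Fin d → ℕ)).sum = β := by
  rw [← Fin.sum_univ_def]
  exact Finset.univ_sum_single β

/-- This merges the derivatives in `x` and in `y` of a function of `x - y` into a single
multi-index. -/
lemma multiDeriv_multiDeriv (hU : IsOpen U) (hf : ContDiffOn ℝ ∞ f U) (β γ : Fin d → ℕ) :
    Set.EqOn (multiDeriv β (multiDeriv γ f)) (multiDeriv (β + γ) f) U := by
  have key : ∀ l : List (Fin d), Set.EqOn
      (l.foldr (fun i G => (partialDeriv i)^[β i] G) (multiDeriv γ f))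
      (multiDeriv ((l.map fun i => (Pi.single i (β i) : Fin d → ℕ)).sum + γ) f) U := by
    intro l
    induction l with
    | nil => simpa using Set.eqOn_refl _ _
    | cons i l ih =>
      rw [List.map_cons, List.sum_cons, add_assoc, add_comm]
      exact (eqOn_iterate_partialDeriv hU ih i _).trans
        (iterate_partialDeriv_multiDeriv hU hf _ i _)
  have := key (List.finRange d)
  rwa [sum_finRange_single] at this

end partialDerivatives

/-! ### The Green function and its derivatives -/

section green

variable {d : ℕ}

lemma partialDeriv_comp_const_sub (f : EuclideanSpace ℝ (Fin d) → ℝ) (i : Fin d)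
    (x : EuclideanSpace ℝ (Fin d)) :
    partialDeriv i (fun y => f (x - y)) = fun y => -partialDeriv i f (x - y) := by
  funext y
  simp only [partialDeriv]
  have h1 : (fun y => f (x - y)) = fun y => (f ∘ (ContinuousLinearEquiv.neg ℝ)) (y - x) := by
    funext y; simp
  rw [h1, fderiv_comp_sub, ContinuousLinearEquiv.comp_right_fderiv]
  simp

lemma partialDeriv_const_mul (c : ℝ) (f : EuclideanSpace ℝ (Fin d) → ℝ) (i : Fin d) :
    partialDeriv i (fun y => c * f y) = fun y => c * partialDeriv i f y := by
  funext y
  simp only [partialDeriv]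
  change fderiv ℝ (c • f) y _ = _
  rw [fderiv_const_smul_field]
  simp

lemma iterate_partialDeriv_const_mul (c : ℝ) (f : EuclideanSpace ℝ (Fin d) → ℝ) (i : Fin d)
    (k : ℕ) :
    (partialDeriv i)^[k] (fun y => c * f y) = fun y => c * (partialDeriv i)^[k] f y := by
  induction k with
  | zero => rfl
  | succ k ih => simp only [Function.iterate_succ_apply', ih, partialDeriv_const_mul]

lemma multiDeriv_const_mul (c : ℝ) (f : EuclideanSpace ℝ (Fin d) → ℝ) (β : Fin d → ℕ) :
    multiDeriv β (fun y => c * f y) = fun y => c * multiDeriv β f y := by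
  unfold multiDeriv
  induction List.finRange d with
  | nil => rfl
  | cons i l ih => simp only [List.foldr_cons, ih, iterate_partialDeriv_const_mul]

lemma multiDeriv_comp_const_sub (f : EuclideanSpace ℝ (Fin d) → ℝ) (β : Fin d → ℕ)
    (x : EuclideanSpace ℝ (Fin d)) :
    multiDeriv β (fun y => f (x - y)) = fun y => (-1) ^ (∑ i, β i) * multiDeriv β f (x - y) := by
  have hk : ∀ (i : Fin d) (k : ℕ) (f : EuclideanSpace ℝ (Fin d) → ℝ),
      (partialDeriv i)^[k] (fun y => f (x - y)) =
        fun y => (-1) ^ k * (partialDeriv i)^[k] f (x - y) := by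
    intro i k f
    induction k with
    | zero => simp
    | succ k ih =>
      simp only [Function.iterate_succ_apply', ih, partialDeriv_const_mul,
        partialDeriv_comp_const_sub, pow_succ]
      funext y; ring
  have key : ∀ l : List (Fin d), l.foldr (fun i G => (partialDeriv i)^[β i] G) (fun y => f (x - y))
      = fun y => (-1) ^ (l.map β).sum * l.foldr (fun i G => (partialDeriv i)^[β i] G) f (x - y) := by
    intro l
    induction l with
    | nil => simp
    | cons i l ih =>
      simp only [List.foldr_cons, ih, iterate_partialDeriv_const_mul, hk, List.map_cons,
        List.sum_cons, pow_add]
      funext y; ring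
  rw [Fin.sum_univ_def]
  exact key _

lemma multiDeriv_comp_sub_const (f : EuclideanSpace ℝ (Fin d) → ℝ) (β : Fin d → ℕ)
    (b : EuclideanSpace ℝ (Fin d)) :
    multiDeriv β (fun x => f (x - b)) = fun x => multiDeriv β f (x - b) := by
  have hk : ∀ (i : Fin d) (k : ℕ) (f : EuclideanSpace ℝ (Fin d) → ℝ),
      (partialDeriv i)^[k] (fun x => f (x - b)) = fun x => (partialDeriv i)^[k] f (x - b) := by
    intro i k f
    induction k with
    | zero => rfl
    | succ k ih =>
      simp only [Function.iterate_succ_apply', ih]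
      funext x
      simp only [partialDeriv]
      rw [fderiv_comp_sub]
  unfold multiDeriv
  induction List.finRange d with
  | nil => rfl
  | cons i l ih => simp only [List.foldr_cons, ih, hk]

/-- The function `‖x‖^{-m}`. -/
def invNormPow (d m : ℕ) : EuclideanSpace ℝ (Fin d) → ℝ := fun x => 1 / ‖x‖ ^ m

lemma contDiffOn_invNormPow (m : ℕ) : ContDiffOn ℝ ∞ (invNormPow d m) {0}ᶜ := by
  intro x hx
  have hx' : x ≠ 0 := hx
  exact (contDiffAt_const.div ((contDiffAt_norm ℝ hx').pow m)
    (pow_ne_zero _ (norm_ne_zero_iff.2 hx'))).contDiffWithinAt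

lemma contDiff_coord (i : Fin d) : ContDiff ℝ ∞ fun x : EuclideanSpace ℝ (Fin d) => x i :=
  (EuclideanSpace.proj i : EuclideanSpace ℝ (Fin d) →L[ℝ] ℝ).contDiff

lemma partialDeriv_coord (i j : Fin d) (x : EuclideanSpace ℝ (Fin d)) :
    partialDeriv i (fun y => y j) x = if i = j then 1 else 0 := by
  have : fderiv ℝ (fun y : EuclideanSpace ℝ (Fin d) => y j) x =
      (EuclideanSpace.proj j : EuclideanSpace ℝ (Fin d) →L[ℝ] ℝ) :=
    (EuclideanSpace.proj j : EuclideanSpace ℝ (Fin d) →L[ℝ] ℝ).fderiv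
  simp [partialDeriv, this, eq_comm]

lemma partialDeriv_invNormPow (m : ℕ) (i : Fin d) :
    Set.EqOn (partialDeriv i (invNormPow d m)) (fun x => -(m : ℝ) * (x i * invNormPow d (m + 2) x))
      {0}ᶜ := by
  intro x hx
  have hx' : ‖x‖ ≠ 0 := norm_ne_zero_iff.2 hx
  have hn : HasFDerivAt (fun y : EuclideanSpace ℝ (Fin d) => ‖y‖) (‖x‖⁻¹ • innerSL ℝ x) x := by
    -- The norm is differentiated away from the origin as the square root of `‖x‖²`.
    have h := (hasStrictFDerivAt_norm_sq x).hasFDerivAt.sqrt (pow_ne_zero 2 hx')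
    simp only [Real.sqrt_sq (norm_nonneg _)] at h
    have e : (1 / (2 * ‖x‖)) • (2 : ℕ) • innerSL ℝ x = ‖x‖⁻¹ • innerSL ℝ x := by
      rw [← Nat.cast_smul_eq_nsmul ℝ, smul_smul]
      congr 1
      field_simp
      norm_num
    rwa [e] at h
  have h := (hasDerivAt_zpow (-(m : ℤ)) ‖x‖ (Or.inl hx')).comp_hasFDerivAt x hn
  have he : invNormPow d m = (fun t : ℝ => t ^ (-(m : ℤ))) ∘ fun y => ‖y‖ := by
    funext y; simp [invNormPow]
  simp only [partialDeriv]
  rw [he, h.fderiv]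
  have hz : ‖x‖ ^ (-(m : ℤ) - 1) = ‖x‖ / ‖x‖ ^ (m + 2) := by
    rw [zpow_sub₀ hx', zpow_neg]
    field_simp
    simp [pow_add]
  simp [invNormPow, EuclideanSpace.inner_single_right, hz]
  field_simp

lemma partialDeriv_partialDeriv_invNormPow (m : ℕ) (i : Fin d) :
    Set.EqOn (partialDeriv i (partialDeriv i (invNormPow d m)))
      (fun x => -(m : ℝ) * invNormPow d (m + 2) x +
        m * (m + 2) * (x i ^ 2 * invNormPow d (m + 4) x)) {0}ᶜ := by
  have hU : IsOpen ({0}ᶜ : Set (EuclideanSpace ℝ (Fin d))) := isOpen_compl_singleton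
  intro x hx
  rw [eqOn_partialDeriv hU (partialDeriv_invNormPow m i) i hx, partialDeriv_const_mul]
  simp only
  rw [partialDeriv_mul (contDiff_coord i).contDiffOn (contDiffOn_invNormPow (m + 2)) hU i hx]
  simp only
  rw [partialDeriv_coord, partialDeriv_invNormPow (m + 2) i hx]
  push_cast
  simp only [if_true]
  ring

/-- General `m` is needed: `m = d - 2` gives harmonicity of the Green function, and larger exponents
drive the recursion in `derivSqSum_invNormPow`. -/
lemma laplacian_invNormPow (m : ℕ) {x : EuclideanSpace ℝ (Fin d)} (hx : x ≠ 0) :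
    ∑ i, partialDeriv i (partialDeriv i (invNormPow d m)) x =
      m * (m + 2 - d) * invNormPow d (m + 2) x := by
  rw [Finset.sum_congr rfl fun i _ => partialDeriv_partialDeriv_invNormPow m i hx]
  rw [Finset.sum_add_distrib, ← Finset.mul_sum, ← Finset.mul_sum, ← Finset.sum_mul]
  have hx' : ‖x‖ ≠ 0 := norm_ne_zero_iff.2 hx
  have h : (∑ i, x i ^ 2) * invNormPow d (m + 4) x = invNormPow d (m + 2) x := by
    rw [← EuclideanSpace.real_norm_sq_eq, invNormPow, invNormPow]
    field_simp
    ring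
  rw [h]
  simp
  ring

lemma greenDeriv_eq (β γ : Fin d → ℕ) {a b : EuclideanSpace ℝ (Fin d)} (hab : a ≠ b) :
    greenDeriv β γ a b =
      (-1) ^ (∑ i, γ i) * multiDeriv (β + γ) (invNormPow d (d - 2)) (a - b) := by
  have h : ∀ x : EuclideanSpace ℝ (Fin d),
      multiDeriv γ (fun y => 1 / ‖x - y‖ ^ (d - 2)) b =
        (-1) ^ (∑ i, γ i) * multiDeriv γ (invNormPow d (d - 2)) (x - b) := fun x =>
    congrFun (multiDeriv_comp_const_sub (invNormPow d (d - 2)) γ x) b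
  simp only [greenDeriv, h, multiDeriv_const_mul]
  rw [multiDeriv_comp_sub_const]
  simp only
  rw [multiDeriv_multiDeriv isOpen_compl_singleton (contDiffOn_invNormPow _) β γ
    (sub_ne_zero.2 hab)]

end green

/-! ### Sums over multi-indices of given degree -/

section multiSum

variable {d : ℕ}

/-- The sum of `φ` over all words of length `n` in the letters `Fin d`, where `φ` is evaluated at
the multi-index that counts the letters. -/
def multiSum : ℕ → ((Fin d →₀ ℕ) → ℝ) → ℝ
  | 0, φ => φ 0
  | n + 1, φ => ∑ i, multiSum n fun α => φ (α + Finsupp.single i 1)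

lemma multiSum_succ (n : ℕ) (φ : (Fin d →₀ ℕ) → ℝ) :
    multiSum (n + 1) φ = ∑ i, multiSum n fun α => φ (α + Finsupp.single i 1) := rfl

lemma multiSum_sum {ι : Type*} (s : Finset ι) (n : ℕ) (φ : ι → (Fin d →₀ ℕ) → ℝ) :
    multiSum n (fun α => ∑ k ∈ s, φ k α) = ∑ k ∈ s, multiSum n (φ k) := by
  induction n generalizing φ with
  | zero => rfl
  | succ n ih =>
    simp only [multiSum_succ]
    rw [Finset.sum_comm]
    exact Finset.sum_congr rfl fun i _ => ih fun k α => φ k (α + Finsupp.single i 1)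

lemma multiSum_const_mul (c : ℝ) (n : ℕ) (φ : (Fin d →₀ ℕ) → ℝ) :
    multiSum n (fun α => c * φ α) = c * multiSum n φ := by
  induction n generalizing φ with
  | zero => rfl
  | succ n ih =>
    simp only [multiSum_succ, Finset.mul_sum]
    exact Finset.sum_congr rfl fun i _ => ih fun α => φ (α + Finsupp.single i 1)

/-- A word of length `n + m` is a word of length `n` followed by one of length `m`. This is the
reason to sum over words: the sums in `β` and in `γ` merge into one sum depending only on `β + γ`.
-/
lemma multiSum_add_index (n m : ℕ) (φ : (Fin d →₀ ℕ) → ℝ) :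
    multiSum n (fun β => multiSum m fun γ => φ (β + γ)) = multiSum (n + m) φ := by
  induction n generalizing φ with
  | zero => simp [multiSum]
  | succ n ih =>
    rw [Nat.succ_add, multiSum_succ, multiSum_succ]
    refine Finset.sum_congr rfl fun i _ => ?_
    rw [← ih]
    simp only [add_right_comm]

/-- The factorial `α! = ∏ α_i!`. -/
def multiFactorial (α : Fin d →₀ ℕ) : ℝ := ∏ i, ((α i).factorial : ℝ)

lemma multiFactorial_pos (α : Fin d →₀ ℕ) : 0 < multiFactorial α :=
  Finset.prod_pos fun i _ => by positivity

lemma multiFactorial_add_single (α : Fin d →₀ ℕ) (i : Fin d) :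
    multiFactorial (α + Finsupp.single i 1) = (α i + 1) * multiFactorial α := by
  rw [multiFactorial, multiFactorial, ← Finset.mul_prod_erase _ _ (Finset.mem_univ i),
    ← Finset.mul_prod_erase _ (fun j => ((α j).factorial : ℝ)) (Finset.mem_univ i)]
  have : ∀ j ∈ Finset.univ.erase i,
      (((α + Finsupp.single i 1 : Fin d →₀ ℕ) j).factorial : ℝ) = ((α j).factorial : ℝ) := by
    intro j hj
    simp [(Finset.ne_of_mem_erase hj).symm]
  rw [Finset.prod_congr rfl this]
  simp [Nat.factorial_succ]
  ring

/-- The multi-indices of degree `n`. -/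
def degreeEq (d n : ℕ) : Finset (Fin d →₀ ℕ) := Finset.finsuppAntidiag Finset.univ n

lemma mem_degreeEq {n : ℕ} {α : Fin d →₀ ℕ} : α ∈ degreeEq d n ↔ α.degree = n := by
  rw [degreeEq, Finset.mem_finsuppAntidiag, Finsupp.degree_eq_sum]
  simp

/-- Reindex by `α = β + eᵢ`, for which `1/β! = αᵢ/α!`; the multi-indices `α` not of this form have
`αᵢ = 0` and contribute nothing. -/
lemma sum_degreeEq_add_single (n : ℕ) (i : Fin d) (φ : (Fin d →₀ ℕ) → ℝ) :
    ∑ β ∈ degreeEq d n, φ (β + Finsupp.single i 1) / multiFactorial β =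
      ∑ α ∈ degreeEq d (n + 1), α i * (φ α / multiFactorial α) := by
  refine Finset.sum_bij_ne_zero (fun β _ _ => β + Finsupp.single i 1) ?_ ?_ ?_ ?_
  · intro β hβ _
    rw [mem_degreeEq] at *
    simp [hβ]
  · intro β _ _ β' _ _ h
    exact add_right_cancel h
  · intro α hα h0
    have hi : α i ≠ 0 := fun e => h0 (by simp [e])
    have hs : Finsupp.single i 1 ≤ α := by
      rw [Finsupp.single_le_iff]; omega
    have hα' : α - Finsupp.single i 1 + Finsupp.single i 1 = α := tsub_add_cancel_of_le hs
    refine ⟨α - Finsupp.single i 1, ?_, ?_, hα'⟩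
    · rw [mem_degreeEq] at *
      have := congrArg Finsupp.degree hα'
      rw [map_add, Finsupp.degree_single, hα] at this
      omega
    · rw [hα']
      intro h
      rcases div_eq_zero_iff.1 h with h | h
      · exact h0 (by simp [h])
      · exact (multiFactorial_pos _).ne' h
  · intro β _ _
    rw [multiFactorial_add_single]
    have := (multiFactorial_pos β).ne'
    have h1 : ((β i : ℝ) + 1) ≠ 0 := by positivity
    simp
    field_simp

/-- A multi-index `α` of degree `n` is the letter count of `n!/α!` words. In the induction, `∑ᵢ αᵢ =
n + 1` supplies the new factor of the factorial. -/
lemma factorial_mul_sum_degreeEq (n : ℕ) (φ : (Fin d →₀ ℕ) → ℝ) :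
    n.factorial * ∑ α ∈ degreeEq d n, φ α / multiFactorial α = multiSum n φ := by
  induction n generalizing φ with
  | zero =>
    have : degreeEq d 0 = {0} := by
      ext α
      simp [mem_degreeEq, Finsupp.degree_eq_zero_iff]
    simp [this, multiSum, multiFactorial]
  | succ n ih =>
    rw [multiSum_succ]
    simp only [← ih]
    rw [← Finset.mul_sum, Finset.sum_congr rfl fun i _ => sum_degreeEq_add_single n i φ,
      Finset.sum_comm, Nat.factorial_succ]
    have : ∀ α ∈ degreeEq d (n + 1), ∑ i, (α i : ℝ) * (φ α / multiFactorial α) =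
        (n + 1) * (φ α / multiFactorial α) := by
      intro α hα
      rw [mem_degreeEq, Finsupp.degree_eq_sum] at hα
      rw [← Finset.sum_mul, ← Nat.cast_sum, hα]
      push_cast; ring
    rw [Finset.sum_congr rfl this, ← Finset.mul_sum]
    push_cast; ring

end multiSum

/-! ### Sums of squares of derivatives of a harmonic function -/

section harmonic

variable {d : ℕ} {U : Set (EuclideanSpace ℝ (Fin d))} {f : EuclideanSpace ℝ (Fin d) → ℝ}

/-- Smooth harmonic functions on `U`. -/
structure IsHarmonicOn (f : EuclideanSpace ℝ (Fin d) → ℝ) (U : Set (EuclideanSpace ℝ (Fin d))) :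
    Prop where
  smooth : ContDiffOn ℝ ∞ f U
  laplacian_eq : ∀ x ∈ U, ∑ i, partialDeriv i (partialDeriv i f) x = 0

lemma IsHarmonicOn.partialDeriv (hf : IsHarmonicOn f U) (hU : IsOpen U) (j : Fin d) :
    IsHarmonicOn (partialDeriv j f) U where
  smooth := contDiffOn_partialDeriv hU hf.smooth j
  laplacian_eq x hx := by
    have h1 : ∀ i, HarmPoly.partialDeriv i (HarmPoly.partialDeriv i (HarmPoly.partialDeriv j f)) x
        = HarmPoly.partialDeriv j (HarmPoly.partialDeriv i (HarmPoly.partialDeriv i f)) x := by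
      intro i
      rw [eqOn_partialDeriv hU (partialDeriv_comm hU hf.smooth i j) i hx,
        partialDeriv_comm hU (contDiffOn_partialDeriv hU hf.smooth i) i j hx]
    rw [Finset.sum_congr rfl fun i _ => h1 i]
    have h2 := partialDeriv_sum Finset.univ (fun i _ => contDiffOn_partialDeriv hU
      (contDiffOn_partialDeriv hU hf.smooth i) i) hU j hx
    simp only at h2
    rw [← h2, eqOn_partialDeriv hU (g := fun _ => 0) (fun y hy => hf.laplacian_eq y hy) j hx]
    simp [HarmPoly.partialDeriv]

lemma IsHarmonicOn.multiDeriv (hf : IsHarmonicOn f U) (hU : IsOpen U) (β : Fin d → ℕ) :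
    IsHarmonicOn (multiDeriv β f) U := by
  have hk : ∀ (k : ℕ) (i : Fin d) {f : EuclideanSpace ℝ (Fin d) → ℝ}, IsHarmonicOn f U →
      IsHarmonicOn ((HarmPoly.partialDeriv i)^[k] f) U := by
    intro k i f hf
    induction k with
    | zero => exact hf
    | succ k ih => rw [Function.iterate_succ_apply']; exact ih.partialDeriv hU i
  unfold HarmPoly.multiDeriv
  induction List.finRange d with
  | nil => exact hf
  | cons i l ih => exact hk _ i ih

lemma multiDeriv_finsupp_add_single (hU : IsOpen U) (hf : ContDiffOn ℝ ∞ f U) (α : Fin d →₀ ℕ)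
    (i : Fin d) :
    Set.EqOn (partialDeriv i (multiDeriv α f)) (multiDeriv (α + Finsupp.single i 1 : Fin d →₀ ℕ) f) U := by
  rw [Finsupp.coe_add, Finsupp.single_eq_pi_single]
  exact (multiDeriv_add_single hU hf α i).symm

/-- This is the trace condition that `weightedEval_mulNormSq` requires of a family of values, here
for the derivatives of `f` at a point. -/
lemma IsHarmonicOn.sum_multiDeriv (hf : IsHarmonicOn f U) (hU : IsOpen U) (α : Fin d →₀ ℕ)
    {x : EuclideanSpace ℝ (Fin d)} (hx : x ∈ U) :
    ∑ i, HarmPoly.multiDeriv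
      (α + Finsupp.single i 1 + Finsupp.single i 1 : Fin d →₀ ℕ) f x = 0 := by
  rw [← (hf.multiDeriv hU α).laplacian_eq x hx]
  refine Finset.sum_congr rfl fun i _ => ?_
  rw [eqOn_partialDeriv hU (multiDeriv_finsupp_add_single hU hf.smooth α i) i hx,
    multiDeriv_finsupp_add_single hU hf.smooth _ i hx]

lemma contDiffOn_multiSum (n : ℕ) {F : (Fin d →₀ ℕ) → EuclideanSpace ℝ (Fin d) → ℝ}
    (hF : ∀ α, ContDiffOn ℝ ∞ (F α) U) :
    ContDiffOn ℝ ∞ (fun x => multiSum n fun α => F α x) U := by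
  induction n generalizing F with
  | zero => exact hF 0
  | succ n ih =>
    simp only [multiSum_succ]
    exact ContDiffOn.sum fun i _ => ih fun α => hF (α + Finsupp.single i 1)

lemma partialDeriv_multiSum (hU : IsOpen U) (n : ℕ)
    {F : (Fin d →₀ ℕ) → EuclideanSpace ℝ (Fin d) → ℝ} (hF : ∀ α, ContDiffOn ℝ ∞ (F α) U)
    (j : Fin d) : Set.EqOn (partialDeriv j fun x => multiSum n fun α => F α x)
      (fun x => multiSum n fun α => partialDeriv j (F α) x) U := by
  induction n generalizing F with
  | zero => exact Set.eqOn_refl _ _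
  | succ n ih =>
    simp only [multiSum_succ]
    intro x hx
    rw [partialDeriv_sum _ (fun i _ => contDiffOn_multiSum n fun α => hF _) hU j hx]
    exact Finset.sum_congr rfl fun i _ => ih (fun α => hF (α + Finsupp.single i 1)) hx

lemma partialDeriv_partialDeriv_sq (hU : IsOpen U) (hf : ContDiffOn ℝ ∞ f U) (i : Fin d)
    {x : EuclideanSpace ℝ (Fin d)} (hx : x ∈ U) :
    partialDeriv i (partialDeriv i fun y => f y ^ 2) x =
      2 * partialDeriv i f x ^ 2 + 2 * f x * partialDeriv i (partialDeriv i f) x := by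
  have h1 : Set.EqOn (partialDeriv i fun y => f y ^ 2)
      (fun y => 2 * (f y * partialDeriv i f y)) U := by
    intro y hy
    simp only [sq]
    rw [partialDeriv_mul hf hf hU i hy]
    ring
  rw [eqOn_partialDeriv hU h1 i hx, partialDeriv_const_mul]
  simp only
  rw [partialDeriv_mul hf (contDiffOn_partialDeriv hU hf i) hU i hx]
  ring

/-- The sum of the squares of all partial derivatives of order `n`. -/
def derivSqSum (n : ℕ) (f : EuclideanSpace ℝ (Fin d) → ℝ) (x : EuclideanSpace ℝ (Fin d)) : ℝ :=
  multiSum n fun α => multiDeriv α f x ^ 2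

/-- For harmonic `g` one has `Δ(g²) = 2 ∑ᵢ (∂ᵢ g)²`. Apply this to each `g = ∂^α f`; the letter `i`
then lengthens the word by one. -/
lemma IsHarmonicOn.laplacian_derivSqSum (hf : IsHarmonicOn f U) (hU : IsOpen U) (n : ℕ)
    {x : EuclideanSpace ℝ (Fin d)} (hx : x ∈ U) :
    ∑ i, HarmPoly.partialDeriv i (HarmPoly.partialDeriv i (derivSqSum n f)) x =
      2 * derivSqSum (n + 1) f x := by
  have hs : ∀ α : Fin d →₀ ℕ, ContDiffOn ℝ ∞ (fun x => HarmPoly.multiDeriv α f x ^ 2) U :=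
    fun α => (contDiffOn_multiDeriv hU hf.smooth α).pow 2
  have h1 : ∀ i, HarmPoly.partialDeriv i (HarmPoly.partialDeriv i (derivSqSum n f)) x =
      multiSum n fun α => HarmPoly.partialDeriv i
        (HarmPoly.partialDeriv i fun y => HarmPoly.multiDeriv α f y ^ 2) x := by
    intro i
    unfold derivSqSum
    rw [eqOn_partialDeriv hU (partialDeriv_multiSum hU n hs i) i hx,
      partialDeriv_multiSum hU n (fun α => contDiffOn_partialDeriv hU (hs α) i) i hx]
  rw [Finset.sum_congr rfl fun i _ => h1 i, ← multiSum_sum, derivSqSum, multiSum_succ,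
    ← multiSum_sum, ← multiSum_const_mul]
  congr 1
  funext α
  rw [Finset.sum_congr rfl fun i _ => partialDeriv_partialDeriv_sq hU
    (contDiffOn_multiDeriv hU hf.smooth α) i hx, Finset.sum_add_distrib, ← Finset.mul_sum,
    ← Finset.mul_sum, (hf.multiDeriv hU α).laplacian_eq x hx, mul_zero, add_zero]
  congr 1
  exact Finset.sum_congr rfl fun i _ => by
    rw [multiDeriv_finsupp_add_single hU hf.smooth α i hx]

lemma isHarmonicOn_invNormPow (hd : 2 ≤ d) : IsHarmonicOn (invNormPow d (d - 2)) {0}ᶜ where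
  smooth := contDiffOn_invNormPow _
  laplacian_eq x hx := by
    rw [laplacian_invNormPow _ hx, Nat.cast_sub hd]
    push_cast; ring

lemma derivSqSum_invNormPow (hd : 2 ≤ d) (n : ℕ) : Set.EqOn
    (derivSqSum n (invNormPow d (d - 2)))
    (fun x => (∏ j ∈ Finset.range n, ((d - 2 + j : ℝ) * (d - 2 + 2 * j))) *
      invNormPow d (2 * (d - 2) + 2 * n) x) {0}ᶜ := by
  have hU : IsOpen ({0}ᶜ : Set (EuclideanSpace ℝ (Fin d))) := isOpen_compl_singleton
  induction n with
  | zero =>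
    intro x _
    simp [derivSqSum, multiSum, multiDeriv_zero, invNormPow, ← pow_mul, mul_comm]
  | succ n ih =>
    intro x hx
    have h := (isHarmonicOn_invNormPow hd).laplacian_derivSqSum hU n hx
    rw [Finset.sum_congr rfl fun i _ =>
      eqOn_partialDeriv hU (eqOn_partialDeriv hU ih i) i hx] at h
    simp only [partialDeriv_const_mul] at h
    rw [← Finset.mul_sum, laplacian_invNormPow _ hx] at h
    push_cast [Nat.cast_sub hd] at h
    simp only
    rw [Finset.prod_range_succ, Nat.mul_succ, ← add_assoc]
    -- For `k = 2(d-2) + 2n`, the Laplacian factor `k(k + 2 - d)` equals `2(d-2+n)(d-2+2n)`; its 2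
    -- cancels the one in the recursion.
    linear_combination (-1 / 2 : ℝ) * h

end harmonic

/-! ### Linear maps determined by their values on `P^β 1` -/

section weightedEval

variable {d : ℕ} {M : Type*} [AddCommGroup M] [Module ℝ M]

/-- The linear map that sends `x^α` to `φ α` divided by `2^|α| ((d-2)/2)_{|α|}`. -/
def weightedEval (φ : (Fin d →₀ ℕ) → M) : Poly d →ₗ[ℝ] M :=
  (basisMonomials (Fin d) ℝ).constr ℝ fun α => fischerWeight d α.degree • φ α

lemma weightedEval_monomial (φ : (Fin d →₀ ℕ) → M) (α : Fin d →₀ ℕ) (c : ℝ) :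
    weightedEval φ (monomial α c) = c • fischerWeight d α.degree • φ α := by
  have h : (monomial α c : Poly d) = c • (basisMonomials (Fin d) ℝ α) := by
    simp [smul_monomial]
  rw [h, map_smul, weightedEval, Module.Basis.constr_basis]

lemma weightedEval_apply (φ : (Fin d →₀ ℕ) → M) (f : Poly d) :
    weightedEval φ f = ∑ α ∈ f.support, coeff α f • fischerWeight d α.degree • φ α := by
  conv_lhs => rw [f.as_sum]
  simp only [map_sum, weightedEval_monomial]

lemma mulX_monomial (i : Fin d) (α : Fin d →₀ ℕ) (c : ℝ) :
    (mulX i (monomial α c) : Poly d) = monomial (α + Finsupp.single i 1) c := by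
  rw [mulX_apply, X, monomial_mul, one_mul, add_comm]

/-- All monomials of `‖x‖² x^α` have the same degree, so the weight factors out and the trace
condition on `φ` remains. -/
lemma weightedEval_mulNormSq {φ : (Fin d →₀ ℕ) → M}
    (hφ : ∀ α, ∑ i, φ (α + Finsupp.single i 1 + Finsupp.single i 1) = 0) (f : Poly d) :
    weightedEval φ (mulNormSq d f) = 0 := by
  induction f using MvPolynomial.induction_on' with
  | add p q hp hq => rw [map_add, map_add, hp, hq, add_zero]
  | monomial α c =>
    simp only [mulNormSq_apply, map_sum, mulX_monomial, weightedEval_monomial, map_add,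
      Finsupp.degree_single, ← Finset.smul_sum, hφ, smul_zero]

/-- The term with `‖x‖²` vanishes. On degree `n` the rest of `P_μ` multiplies by `(2n + d - 2) x_μ`,
and `(2n + d - 2) w(n+1) = w(n)` for `w = fischerWeight d`: the weight is chosen to make `P_μ` a
pure shift. -/
lemma weightedEval_polyP (hd : 3 ≤ d) {φ : (Fin d →₀ ℕ) → M}
    (hφ : ∀ α, ∑ i, φ (α + Finsupp.single i 1 + Finsupp.single i 1) = 0) (μ : Fin d)
    (f : Poly d) :
    weightedEval φ (polyP μ f) = weightedEval (fun α => φ (α + Finsupp.single μ 1)) f := by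
  rw [polyP_apply, map_sub, weightedEval_mulNormSq hφ, sub_zero]
  induction f using MvPolynomial.induction_on' with
  | add p q hp hq =>
    rw [(weightedEval fun α => φ (α + Finsupp.single μ 1)).map_add, ← hp, ← hq]
    simp only [map_add, smul_add]
    abel
  | monomial α c =>
    simp only [euler_monomial, map_add, map_smul, mulX_monomial, weightedEval_monomial,
      Finsupp.degree_single]
    rw [← fischerWeight_succ hd α.degree]
    module

lemma weightedEval_opP_pow (hd : 3 ≤ d) {φ : (Fin d →₀ ℕ) → M}
    (hφ : ∀ α, ∑ i, φ (α + Finsupp.single i 1 + Finsupp.single i 1) = 0) (μ : Fin d) (k : ℕ)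
    (u : Harm d) :
    weightedEval φ ((opP μ ^ k) u : Harm d) =
      weightedEval (fun α => φ (α + Finsupp.single μ k)) (u : Poly d) := by
  induction k generalizing u with
  | zero => simp
  | succ k ih =>
    rw [pow_succ, Module.End.mul_apply, ih]
    change weightedEval _ (polyP μ (u : Poly d)) = _
    rw [weightedEval_polyP hd]
    · congr 2
      funext α
      rw [add_assoc, add_comm (Finsupp.single μ 1), ← Finsupp.single_add]
    · intro α
      rw [← hφ (α + Finsupp.single μ k)]
      exact Finset.sum_congr rfl fun i _ => congrArg φ (by abel)

lemma weightedEval_opPPow (hd : 3 ≤ d) {φ : (Fin d →₀ ℕ) → M}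
    (hφ : ∀ α, ∑ i, φ (α + Finsupp.single i 1 + Finsupp.single i 1) = 0) (β : Fin d → ℕ)
    (u : Harm d) :
    weightedEval φ (opPPow β u : Harm d) =
      weightedEval (fun α => φ (α + Finsupp.equivFunOnFinite.symm β)) (u : Poly d) := by
  have key : ∀ (l : List (Fin d)) (φ : (Fin d →₀ ℕ) → M),
      (∀ α, ∑ i, φ (α + Finsupp.single i 1 + Finsupp.single i 1) = 0) →
      weightedEval φ ((l.map fun μ => opP μ ^ β μ).prod u : Harm d) =
        weightedEval (fun α => φ (α + (l.map fun μ => Finsupp.single μ (β μ)).sum))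
          (u : Poly d) := by
    intro l
    induction l with
    | nil => intro φ _; simp
    | cons i l ih =>
      intro φ hφ
      rw [List.map_cons, List.prod_cons, Module.End.mul_apply, weightedEval_opP_pow hd hφ, ih]
      · simp only [List.map_cons, List.sum_cons, add_assoc, add_comm (Finsupp.single i (β i))]
      · intro α
        rw [← hφ (α + Finsupp.single i (β i))]
        exact Finset.sum_congr rfl fun j _ => congrArg φ (by abel)
  rw [opPPow, key _ φ hφ, ← Fin.sum_univ_def]
  congr 2
  funext α
  congr 2
  ext i
  simp [Finsupp.finsetSum_apply, Finsupp.single_apply]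

lemma weightedEval_opPPow_vac (hd : 3 ≤ d) {φ : (Fin d →₀ ℕ) → M}
    (hφ : ∀ α, ∑ i, φ (α + Finsupp.single i 1 + Finsupp.single i 1) = 0) (β : Fin d → ℕ) :
    weightedEval φ (opPPow β (vac d) : Harm d) = φ (Finsupp.equivFunOnFinite.symm β) := by
  have h : ((vac d : Harm d) : Poly d) = monomial 0 1 := rfl
  rw [weightedEval_opPPow hd hφ, h, weightedEval_monomial]
  simp [fischerWeight]

end weightedEval

/-! ### The vectors `P^β 1` span `Harm_d` -/

section span

variable {d : ℕ}

/-- The adjoints `K_i = ∂_i` commute and the form is definite, so no direct computation with `P_i`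
is needed. -/
lemma opP_commute (hd : 3 ≤ d) (i j : Fin d) : Commute (opP i) (opP j) := by
  have hB := fischerHarm_invariant hd
  refine LinearMap.ext fun u => sub_eq_zero.1 (fischerHarm_definite hd _ ?_)
  suffices h : ∀ w, fischerHarm d ((opP i * opP j) u - (opP j * opP i) u) w = 0 from h _
  intro w
  have hK : ∀ v : Harm d, opK j (opK i v) = opK i (opK j v) := fun v => Subtype.ext (del_del j i _)
  rw [map_sub, LinearMap.sub_apply]
  simp only [Module.End.mul_apply, hB.inv_P, hK, sub_self]

lemma list_prod_pow_add_single {R : Type*} [Monoid R] {ι : Type*} [DecidableEq ι] (f : ι → R)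
    (hf : ∀ i j, Commute (f i) (f j)) (β : ι → ℕ) (i : ι) (l : List ι) (hl : l.Nodup)
    (hi : i ∈ l) :
    (l.map fun j => f j ^ (β + Pi.single i 1 : ι → ℕ) j).prod =
      f i * (l.map fun j => f j ^ β j).prod := by
  induction l with
  | nil => simp at hi
  | cons j l ih =>
    obtain ⟨hj, hl'⟩ := List.nodup_cons.1 hl
    simp only [List.map_cons, List.prod_cons]
    by_cases hij : i = j
    · subst hij
      have : ∀ k ∈ l, f k ^ (β + Pi.single i 1 : ι → ℕ) k = f k ^ β k := fun k hk => by
        have : k ≠ i := fun e => hj (e ▸ hk)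
        simp [this]
      rw [List.map_congr_left this, ← mul_assoc, ← pow_succ']
      simp
    · have hi' : i ∈ l := (List.mem_cons.1 hi).resolve_left hij
      have hji : j ≠ i := fun e => hij e.symm
      rw [ih hl' hi', ← mul_assoc, ← mul_assoc, ((hf i j).pow_right (β j)).eq]
      simp [hji]

lemma opP_opPPow (hd : 3 ≤ d) (i : Fin d) (β : Fin d → ℕ) (u : Harm d) :
    opP i (opPPow β u) = opPPow (β + Pi.single i 1) u := by
  rw [opPPow, opPPow, list_prod_pow_add_single opP (opP_commute hd) β i _
    (List.nodup_finRange d) (List.mem_finRange i)]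
  rfl

/-- Induction on the degree: on harmonic polynomials homogeneous of degree `n`, `∑ᵢ PᵢKᵢ` is the
scalar `n(2n + d - 4)`, nonzero for `n ≥ 1`, and each `Kᵢ` lowers the degree. -/
lemma span_opPPow_vac (hd : 3 ≤ d) :
    Submodule.span ℝ (Set.range fun β : Fin d → ℕ => opPPow β (vac d)) = ⊤ := by
  set S := Submodule.span ℝ (Set.range fun β : Fin d → ℕ => opPPow β (vac d))
  have hP : ∀ (i : Fin d), ∀ u ∈ S, opP i u ∈ S := by
    intro i u hu
    induction hu using Submodule.span_induction with
    | mem u hu =>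
      obtain ⟨β, rfl⟩ := hu
      rw [opP_opPPow hd]
      exact Submodule.subset_span ⟨_, rfl⟩
    | zero => simp
    | add u v _ _ hu hv => rw [map_add]; exact S.add_mem hu hv
    | smul c u _ hu => rw [map_smul]; exact S.smul_mem c hu
  have hvac : vac d ∈ S := Submodule.subset_span ⟨0, by simp [opPPow]⟩
  have hcomp : ∀ (n : ℕ) (u : Harm d), comp n u ∈ S := by
    intro n
    induction n with
    | zero =>
      intro u
      obtain ⟨c, hc⟩ := comp_zero u
      rw [hc]
      exact S.smul_mem c hvac
    | succ n ih =>
      intro u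
      have h : ∑ i, opP i (opK i (comp (n + 1) u)) ∈ S := Submodule.sum_mem _ fun i _ => by
        rw [← opK_comp n i u]
        exact hP i _ (ih _)
      rw [sum_opP_opK] at h
      exact (S.smul_mem_iff (factor_ne hd n)).1 h
  refine eq_top_iff.2 fun u _ => ?_
  rw [← sum_comp u]
  exact Submodule.sum_mem _ fun n _ => hcomp n u

end span

/-! ### Existence and uniqueness of the contraction -/

section contraction

variable {d : ℕ} (a : EuclideanSpace ℝ (Fin d)) (r : ℝ) (b : EuclideanSpace ℝ (Fin d)) (s : ℝ)

/-- The value of the contraction at `P^β 1 ⊗ P^γ 1`. -/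
def contractionCoeff (β γ : Fin d →₀ ℕ) : ℝ :=
  r ^ (((d : ℝ) - 2) / 2) * s ^ (((d : ℝ) - 2) / 2) *
    (r ^ β.degree * s ^ γ.degree * ((-1) ^ γ.degree *
      multiDeriv (β + γ : Fin d →₀ ℕ) (invNormPow d (d - 2)) (a - b)))

/-- The contraction `C_{a,r;b,s}`. -/
def contraction : (Harm d ⊗[ℝ] Harm d) →ₗ[ℝ] ℝ :=
  TensorProduct.lift ((weightedEval fun β => weightedEval (contractionCoeff a r b s β)).compl₁₂
    (Harm d).subtype (Harm d).subtype)

lemma contraction_tmul (u v : Harm d) : contraction a r b s (u ⊗ₜ v) =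
    weightedEval (fun β => weightedEval (contractionCoeff a r b s β)) (u : Poly d) (v : Poly d) :=
  rfl

variable {a r b s}

lemma sum_contractionCoeff_left (hd : 2 ≤ d) (hab : a ≠ b) (β γ : Fin d →₀ ℕ) :
    ∑ i, contractionCoeff a r b s (β + Finsupp.single i 1 + Finsupp.single i 1) γ = 0 := by
  have h := (isHarmonicOn_invNormPow hd).sum_multiDeriv isOpen_compl_singleton (β + γ)
    (x := a - b) (sub_ne_zero.2 hab)
  simp only [contractionCoeff, map_add, Finsupp.degree_single, ← Finset.mul_sum]
  have e : ∀ i : Fin d, β + Finsupp.single i 1 + Finsupp.single i 1 + γ =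
      β + γ + Finsupp.single i 1 + Finsupp.single i 1 := fun i => by abel
  simp only [e, h, mul_zero]

lemma sum_contractionCoeff_right (hd : 2 ≤ d) (hab : a ≠ b) (β γ : Fin d →₀ ℕ) :
    ∑ i, contractionCoeff a r b s β (γ + Finsupp.single i 1 + Finsupp.single i 1) = 0 := by
  have h := (isHarmonicOn_invNormPow hd).sum_multiDeriv isOpen_compl_singleton (β + γ)
    (x := a - b) (sub_ne_zero.2 hab)
  simp only [contractionCoeff, map_add, Finsupp.degree_single, ← Finset.mul_sum, ← add_assoc]
  rw [h]
  simp

lemma isContraction_contraction (hd : 3 ≤ d) (hr : 0 < r) (hs : 0 < s) (hab : a ≠ b) :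
    IsContraction a r b s (contraction a r b s) := by
  intro β γ
  have hd2 : 2 ≤ d := by omega
  rw [contraction_tmul, weightedEval_opPPow_vac hd]
  · rw [weightedEval_opPPow_vac hd fun α => sum_contractionCoeff_right hd2 hab _ α]
    rw [greenDeriv_eq β γ hab, contractionCoeff, Real.rpow_add hr, Real.rpow_add hs,
      ← Nat.cast_sum, ← Nat.cast_sum, Real.rpow_natCast, Real.rpow_natCast,
      Finsupp.degree_eq_sum, Finsupp.degree_eq_sum]
    simp only [Finsupp.coe_add, Finsupp.coe_equivFunOnFinite_symm]
    ring
  -- The outer family takes values in linear functionals of the second variable, so its trace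
  -- condition is an equality of functionals, checked on monomials.
  · intro α
    refine (basisMonomials (Fin d) ℝ).ext fun γ => ?_
    simp only [coe_basisMonomials, LinearMap.sum_apply, weightedEval_monomial,
      ← Finset.smul_sum, sum_contractionCoeff_left hd2 hab, smul_zero, LinearMap.zero_apply]

lemma isContraction_unique (hd : 3 ≤ d) {C C' : (Harm d ⊗[ℝ] Harm d) →ₗ[ℝ] ℝ}
    (hC : IsContraction a r b s C) (hC' : IsContraction a r b s C') : C = C' := by
  refine TensorProduct.ext ?_
  refine LinearMap.ext_on_range (v := fun β : Fin d → ℕ => opPPow β (vac d))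
    (span_opPPow_vac hd) fun β => ?_
  refine LinearMap.ext_on_range (v := fun β : Fin d → ℕ => opPPow β (vac d))
    (span_opPPow_vac hd) fun γ => ?_
  exact (hC β γ).trans (hC' β γ).symm

end contraction

/-! ### Square summability of the coefficients of the contraction -/

section estimates

variable {d : ℕ}

/-- Since `d ≥ 3`, `(2n + 1) w(n+1) ≤ w(n)`. The induction hypothesis then gives `w(n+1) 2^n n! ≤
1`, and the remaining factor is `2(n+1) ≤ 2n + 3`. -/
lemma fischerWeight_mul_factorial_le (hd : 3 ≤ d) (n : ℕ) :
    fischerWeight d n * (2 ^ n * n.factorial) ≤ 2 * n + 1 := by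
  have hd' : (3 : ℝ) ≤ d := by exact_mod_cast hd
  induction n with
  | zero => simp [fischerWeight]
  | succ n ih =>
    have hn : (0 : ℝ) ≤ n := Nat.cast_nonneg n
    have hw := fischerWeight_pos hd (n + 1)
    have h : fischerWeight d (n + 1) * (2 ^ n * n.factorial) ≤ 1 := by
      have h1 : (2 * n + 1) * (fischerWeight d (n + 1) * (2 ^ n * n.factorial)) ≤
          (2 * n + 1 : ℝ) * 1 := by
        rw [mul_one]
        refine le_trans ?_ ih
        rw [← fischerWeight_succ hd n, mul_assoc]
        gcongr
        linarith
      exact le_of_mul_le_mul_left h1 (by positivity)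
    rw [pow_succ, Nat.factorial_succ]
    push_cast
    nlinarith

lemma prod_range_add_le (hd : 2 ≤ d) (n : ℕ) :
    ∏ j ∈ Finset.range n, (d - 2 + j : ℝ) ≤ n.factorial * (n + 1) ^ d := by
  have hd' : (2 : ℝ) ≤ d := by exact_mod_cast hd
  induction n with
  | zero => simp
  | succ n ih =>
    have hn : (0 : ℝ) ≤ n := Nat.cast_nonneg n
    have h1 : (d - 2 + n : ℝ) * (n + 1) ^ d ≤ (n + 1) * (n + 2) ^ d := by
      -- Bernoulli's inequality `1 + d/(n+1) ≤ ((n+2)/(n+1))^d` pays for replacing `d - 2 + n` by `n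
      -- + 1`.
      have hb := one_add_mul_le_pow (a := (1 / (n + 1) : ℝ))
        (by have : (0 : ℝ) ≤ 1 / (n + 1) := by positivity
            linarith) d
      have e : (1 + 1 / (n + 1) : ℝ) = (n + 2) / (n + 1) := by field_simp; ring
      rw [e, div_pow, le_div_iff₀ (by positivity)] at hb
      calc (d - 2 + n : ℝ) * (n + 1) ^ d ≤ (n + 1 + d) * (n + 1) ^ d :=
            mul_le_mul_of_nonneg_right (by linarith) (by positivity)
        _ = (n + 1) * ((1 + d * (1 / (n + 1))) * (n + 1) ^ d) := by field_simp
        _ ≤ _ := by gcongr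
    rw [Finset.prod_range_succ, Nat.factorial_succ]
    calc (∏ j ∈ Finset.range n, (d - 2 + j : ℝ)) * (d - 2 + n)
        ≤ n.factorial * (n + 1) ^ d * (d - 2 + n) := by
          gcongr
      _ = n.factorial * ((d - 2 + n : ℝ) * (n + 1) ^ d) := by ring
      _ ≤ n.factorial * ((n + 1) * (n + 2) ^ d) := by gcongr
      _ = _ := by push_cast; ring

lemma prod_range_mul_le (hd : 2 ≤ d) (n : ℕ) :
    ∏ j ∈ Finset.range n, ((d - 2 + j : ℝ) * (d - 2 + 2 * j)) ≤
      2 ^ n * (n.factorial * (n + 1) ^ d) ^ 2 := by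
  have hd' : (2 : ℝ) ≤ d := by exact_mod_cast hd
  have h0 : ∀ j : ℕ, (0 : ℝ) ≤ d - 2 + j := fun j => by
    have : (0 : ℝ) ≤ j := Nat.cast_nonneg j
    linarith
  have h1 : ∏ j ∈ Finset.range n, (d - 2 + 2 * j : ℝ) ≤
      2 ^ n * ∏ j ∈ Finset.range n, (d - 2 + j : ℝ) := by
    have : (2 : ℝ) ^ n = ∏ _j ∈ Finset.range n, (2 : ℝ) := by simp
    rw [this, ← Finset.prod_mul_distrib]
    refine Finset.prod_le_prod (fun j _ => ?_) fun j _ => by linarith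
    have := h0 j
    have : (0 : ℝ) ≤ j := Nat.cast_nonneg j
    linarith
  have hp : 0 ≤ ∏ j ∈ Finset.range n, (d - 2 + j : ℝ) := Finset.prod_nonneg fun j _ => h0 j
  rw [Finset.prod_mul_distrib]
  calc _ ≤ (∏ j ∈ Finset.range n, (d - 2 + j : ℝ)) *
        (2 ^ n * ∏ j ∈ Finset.range n, (d - 2 + j : ℝ)) := by gcongr
    _ = 2 ^ n * (∏ j ∈ Finset.range n, (d - 2 + j : ℝ)) ^ 2 := by ring
    _ ≤ _ := by gcongr; exact prod_range_add_le hd n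

lemma factorial_div_mul_pow_le {x y : ℝ} (hx : 0 ≤ x) (hy : 0 ≤ y) (n m : ℕ) :
    ((n + m).factorial : ℝ) / (n.factorial * m.factorial) * (x ^ n * y ^ m) ≤ (x + y) ^ (n + m) := by
  have hc : ((n + m).factorial : ℝ) / (n.factorial * m.factorial) = ((n + m).choose n : ℝ) := by
    rw [Nat.choose_symm_add]
    rw [div_eq_iff (by positivity), ← mul_assoc]
    exact_mod_cast (Nat.add_choose_mul_factorial_mul_factorial n m).symm
  rw [hc, add_pow]
  have h := Finset.single_le_sum (f := fun k => x ^ k * y ^ (n + m - k) * ((n + m).choose k : ℝ))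
    (s := Finset.range (n + m + 1)) (fun k _ => by positivity) (a := n) (by simp)
  simp only [Nat.add_sub_cancel_left] at h
  linarith

/-- With `N = n + m`, the main factor `2^N N!²/(n! m!)` splits as `(2^n n!)(2^m m!)` times the
square of `N!/(n! m!)`. The weights absorb the first two up to linear factors, and the binomial
coefficient times `x^n y^m` is one term of `(x + y)^N`. -/
lemma weights_mul_pow_le (hd : 3 ≤ d) {x y : ℝ} (hx : 0 ≤ x) (hy : 0 ≤ y) (n m : ℕ) :
    fischerWeight d n * fischerWeight d m *
        (∏ j ∈ Finset.range (n + m), ((d - 2 + j : ℝ) * (d - 2 + 2 * j))) /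
        (n.factorial * m.factorial) * (x ^ (2 * n) * y ^ (2 * m)) ≤
      (2 * (n + m : ℕ) + 1) ^ 2 * ((n + m : ℕ) + 1) ^ (2 * d) * (x + y) ^ (2 * (n + m)) := by
  have hwn := fischerWeight_pos hd n
  have hwm := fischerWeight_pos hd m
  have h1 := prod_range_mul_le (show 2 ≤ d by omega) (n + m)
  have h2 := factorial_div_mul_pow_le hx hy n m
  have h0 : (0 : ℝ) ≤ ((n + m).factorial : ℝ) / (n.factorial * m.factorial) * (x ^ n * y ^ m) := by
    positivity
  calc _ ≤ fischerWeight d n * fischerWeight d m *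
        (2 ^ (n + m) * ((n + m).factorial * ((n + m : ℕ) + 1) ^ d) ^ 2) /
        (n.factorial * m.factorial) * (x ^ (2 * n) * y ^ (2 * m)) := by gcongr
    _ = (fischerWeight d n * (2 ^ n * n.factorial)) * (fischerWeight d m * (2 ^ m * m.factorial)) *
        ((n + m : ℕ) + 1) ^ (2 * d) * (((n + m).factorial : ℝ) / (n.factorial * m.factorial) *
          (x ^ n * y ^ m)) ^ 2 := by
        field_simp
        ring
    _ ≤ (2 * n + 1) * (2 * m + 1) * ((n + m : ℕ) + 1) ^ (2 * d) * ((x + y) ^ (n + m)) ^ 2 := by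
        gcongr
        · exact fischerWeight_mul_factorial_le hd n
        · exact fischerWeight_mul_factorial_le hd m
    _ ≤ (2 * (n + m : ℕ) + 1) * (2 * (n + m : ℕ) + 1) * ((n + m : ℕ) + 1) ^ (2 * d) *
        ((x + y) ^ (n + m)) ^ 2 := by
        gcongr <;> omega
    _ = _ := by ring

lemma exists_poly_mul_pow_le {θ : ℝ} (h0 : 0 ≤ θ) (h1 : θ < 1) (k : ℕ) :
    ∃ K : ℝ, 0 ≤ K ∧ ∀ n : ℕ, (2 * n + 1 : ℝ) ^ 2 * (n + 1) ^ k * θ ^ n ≤ K := by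
  obtain ⟨K, hK⟩ := (tendsto_pow_const_mul_const_pow_of_abs_lt_one (2 + k)
    (abs_lt.2 ⟨by linarith, h1⟩)).bddAbove_range
  have hK' : ∀ n : ℕ, (n : ℝ) ^ (2 + k) * θ ^ n ≤ K := fun n => hK ⟨n, rfl⟩
  have hK0 : 0 ≤ K := le_trans (by positivity) (hK' 1)
  refine ⟨3 ^ (2 + k) * K + 1, by positivity, fun n => ?_⟩
  -- The comparison of `2n + 1` and `n + 1` with `3n` needs `n ≥ 1`; the summand 1 in the constant
  -- covers `n = 0`.
  rcases Nat.eq_zero_or_pos n with rfl | hn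
  · simp; positivity
  · have hn' : (1 : ℝ) ≤ n := by exact_mod_cast hn
    calc (2 * n + 1 : ℝ) ^ 2 * (n + 1) ^ k * θ ^ n
        ≤ (3 * n : ℝ) ^ 2 * (3 * n) ^ k * θ ^ n := by gcongr <;> linarith
      _ = 3 ^ (2 + k) * ((n : ℝ) ^ (2 + k) * θ ^ n) := by ring
      _ ≤ 3 ^ (2 + k) * K := by gcongr; exact hK' n
      _ ≤ _ := by linarith

lemma sum_le_of_degree_sum_le {G : (Fin d →₀ ℕ) × (Fin d →₀ ℕ) → ℝ} (hG : ∀ p, 0 ≤ G p)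
    {K θ : ℝ} (hK : 0 ≤ K) (h0 : 0 ≤ θ) (h1 : θ < 1)
    (h : ∀ n m, ∑ β ∈ degreeEq d n, ∑ γ ∈ degreeEq d m, G (β, γ) ≤ K * θ ^ n * θ ^ m)
    (S : Finset ((Fin d →₀ ℕ) × (Fin d →₀ ℕ))) : ∑ p ∈ S, G p ≤ K * ((1 - θ)⁻¹) ^ 2 := by
  classical
  set M := (S.sup fun p => p.1.degree + p.2.degree) + 1 with hM
  set T : Finset (Fin d →₀ ℕ) := (Finset.range M).biUnion (degreeEq d) with hT
  have hdisj : ((Finset.range M : Finset ℕ) : Set ℕ).PairwiseDisjoint (degreeEq d) := by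
    intro i _ j _ hij
    refine Finset.disjoint_left.2 fun α hi hj => hij ?_
    rw [mem_degreeEq] at hi hj
    exact hi.symm.trans hj
  have hS : S ⊆ T ×ˢ T := by
    intro p hp
    have := Finset.le_sup (f := fun p : (Fin d →₀ ℕ) × (Fin d →₀ ℕ) => p.1.degree + p.2.degree) hp
    simp only [hT, Finset.mem_product, Finset.mem_biUnion, Finset.mem_range, mem_degreeEq]
    exact ⟨⟨_, by omega, rfl⟩, ⟨_, by omega, rfl⟩⟩
  have hgeom : ∑ n ∈ Finset.range M, θ ^ n ≤ (1 - θ)⁻¹ := by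
    rw [← tsum_geometric_of_lt_one h0 h1]
    exact (summable_geometric_of_lt_one h0 h1).sum_le_tsum _ fun _ _ => by positivity
  calc ∑ p ∈ S, G p ≤ ∑ p ∈ T ×ˢ T, G p :=
        Finset.sum_le_sum_of_subset_of_nonneg hS fun p _ _ => hG p
    _ = ∑ n ∈ Finset.range M, ∑ m ∈ Finset.range M,
          ∑ β ∈ degreeEq d n, ∑ γ ∈ degreeEq d m, G (β, γ) := by
        rw [Finset.sum_product, hT, Finset.sum_biUnion hdisj]
        refine Finset.sum_congr rfl fun n _ => ?_
        rw [Finset.sum_comm]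
        rw [Finset.sum_biUnion hdisj]
        exact Finset.sum_congr rfl fun m _ => Finset.sum_comm
    _ ≤ ∑ n ∈ Finset.range M, ∑ m ∈ Finset.range M, K * θ ^ n * θ ^ m :=
        Finset.sum_le_sum fun n _ => Finset.sum_le_sum fun m _ => h n m
    _ = K * (∑ n ∈ Finset.range M, θ ^ n) ^ 2 := by
        simp only [← Finset.mul_sum, ← Finset.sum_mul]
        ring
    _ ≤ _ := by
        gcongr

/-! ### Coefficients of the contraction, summed by bidegree. -/

variable {a b : EuclideanSpace ℝ (Fin d)} {r s : ℝ}

/-- The square of the coefficient of the contraction at a pair of normalised monomials. -/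
def contractionCoeffSq (a : EuclideanSpace ℝ (Fin d)) (r : ℝ) (b : EuclideanSpace ℝ (Fin d)) (s : ℝ)
    (p : (Fin d →₀ ℕ) × (Fin d →₀ ℕ)) : ℝ :=
  fischerWeight d p.1.degree * fischerWeight d p.2.degree * contractionCoeff a r b s p.1 p.2 ^ 2 /
    (multiFactorial p.1 * multiFactorial p.2)

lemma contractionCoeffSq_nonneg (hd : 3 ≤ d) (p : (Fin d →₀ ℕ) × (Fin d →₀ ℕ)) :
    0 ≤ contractionCoeffSq a r b s p := by
  have h1 := fischerWeight_pos hd p.1.degree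
  have h2 := fischerWeight_pos hd p.2.degree
  have h3 := multiFactorial_pos p.1
  have h4 := multiFactorial_pos p.2
  unfold contractionCoeffSq
  positivity

/-- Weights and powers of `r`, `s` depend only on the degrees, and the sign squares to 1. What
remains is the sum of `(∂^{β+γ} G)²/(β! γ!)`, which word sums turn into `derivSqSum` of order `n +
m` over `n! m!`. -/
lemma sum_degreeEq_contractionCoeffSq (hd : 2 ≤ d) (hab : a ≠ b) (n m : ℕ) :
    ∑ β ∈ degreeEq d n, ∑ γ ∈ degreeEq d m, contractionCoeffSq a r b s (β, γ) =
      (r ^ (((d : ℝ) - 2) / 2) * s ^ (((d : ℝ) - 2) / 2)) ^ 2 / ‖a - b‖ ^ (2 * (d - 2)) *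
      (fischerWeight d n * fischerWeight d m *
        (∏ j ∈ Finset.range (n + m), ((d - 2 + j : ℝ) * (d - 2 + 2 * j))) /
        (n.factorial * m.factorial) *
        ((r / ‖a - b‖) ^ (2 * n) * (s / ‖a - b‖) ^ (2 * m))) := by
  set c := (r ^ (((d : ℝ) - 2) / 2) * s ^ (((d : ℝ) - 2) / 2)) with hc
  have h1 : ∀ β ∈ degreeEq d n, ∀ γ ∈ degreeEq d m, contractionCoeffSq a r b s (β, γ) =
      (c ^ 2 * (r ^ (2 * n) * s ^ (2 * m)) * (fischerWeight d n * fischerWeight d m)) *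
        (multiDeriv (β + γ : Fin d →₀ ℕ) (invNormPow d (d - 2)) (a - b) ^ 2 /
          multiFactorial γ / multiFactorial β) := by
    intro β hβ γ hγ
    rw [mem_degreeEq] at hβ hγ
    have hm : ((-1 : ℝ) ^ m) ^ 2 = 1 := by rw [← pow_mul, mul_comm, pow_mul]; simp
    have h3 := (multiFactorial_pos β).ne'
    have h4 := (multiFactorial_pos γ).ne'
    simp only [contractionCoeffSq, contractionCoeff, hβ, hγ, mul_pow, hm, hc]
    field_simp
    ring
  have h2 : ∑ β ∈ degreeEq d n, ∑ γ ∈ degreeEq d m,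
      (multiDeriv (β + γ : Fin d →₀ ℕ) (invNormPow d (d - 2)) (a - b) ^ 2 /
          multiFactorial γ / multiFactorial β) =
      derivSqSum (n + m) (invNormPow d (d - 2)) (a - b) / (n.factorial * m.factorial) := by
    rw [derivSqSum, ← multiSum_add_index n m (fun α =>
      multiDeriv α (invNormPow d (d - 2)) (a - b) ^ 2)]
    simp only [← factorial_mul_sum_degreeEq m, multiSum_const_mul]
    rw [← factorial_mul_sum_degreeEq n]
    simp only [← Finset.sum_div]
    field_simp
  rw [Finset.sum_congr rfl fun β hβ => Finset.sum_congr rfl fun γ hγ => h1 β hβ γ hγ]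
  simp only [← Finset.mul_sum]
  rw [h2, derivSqSum_invNormPow hd (n + m) (x := a - b) (sub_ne_zero.2 hab)]
  have hab' : ‖a - b‖ ≠ 0 := norm_ne_zero_iff.2 (sub_ne_zero.2 hab)
  simp only [invNormPow, div_pow]
  field_simp
  ring

lemma exists_sum_contractionCoeffSq_le (hd : 3 ≤ d) (hr : 0 < r) (hs : 0 < s)
    (hrs : r + s < ‖a - b‖) :
    ∃ K : ℝ, ∀ S : Finset ((Fin d →₀ ℕ) × (Fin d →₀ ℕ)),
      ∑ p ∈ S, contractionCoeffSq a r b s p ≤ K := by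
  have hρ : 0 < ‖a - b‖ := by linarith
  have hab : a ≠ b := sub_ne_zero.1 (norm_pos_iff.1 hρ)
  set x := r / ‖a - b‖ with hx
  set y := s / ‖a - b‖ with hy
  have hx0 : 0 ≤ x := by positivity
  have hy0 : 0 ≤ y := by positivity
  have h0 : 0 ≤ x + y := by positivity
  have h1 : x + y < 1 := by rw [hx, hy, ← add_div, div_lt_one hρ]; exact hrs
  obtain ⟨K, hK0, hK⟩ := exists_poly_mul_pow_le h0 h1 (2 * d)
  set c := (r ^ (((d : ℝ) - 2) / 2) * s ^ (((d : ℝ) - 2) / 2)) ^ 2 / ‖a - b‖ ^ (2 * (d - 2)) with hc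
  have hc0 : 0 ≤ c := by positivity
  refine ⟨_, fun S => sum_le_of_degree_sum_le (K := c * K) (θ := x + y)
    (contractionCoeffSq_nonneg hd) (by positivity) h0 h1 (fun n m => ?_) S⟩
  rw [sum_degreeEq_contractionCoeffSq (by omega) hab]
  calc _ ≤ c * ((2 * (n + m : ℕ) + 1) ^ 2 * ((n + m : ℕ) + 1) ^ (2 * d) *
        (x + y) ^ (2 * (n + m))) :=
        mul_le_mul_of_nonneg_left (weights_mul_pow_le hd hx0 hy0 n m) hc0
    -- Half of the `2(n + m)` powers absorb the polynomial factor; the other half give the geometric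
    -- decay.
    _ = c * ((2 * (n + m : ℕ) + 1) ^ 2 * ((n + m : ℕ) + 1) ^ (2 * d) *
        (x + y) ^ (n + m)) * (x + y) ^ (n + m) := by ring
    _ ≤ c * K * (x + y) ^ (n + m) := by
        gcongr
        exact hK (n + m)
    _ = _ := by ring

end estimates

/-! ### Boundedness of the contraction and its extension -/

section coefficients

variable {d : ℕ}

/-- The coefficient of `x^β ⊗ x^γ` in an element of `Harm_d ⊗ Harm_d`. -/
def tensorCoeff (p : (Fin d →₀ ℕ) × (Fin d →₀ ℕ)) : (Harm d ⊗[ℝ] Harm d) →ₗ[ℝ] ℝ :=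
  TensorProduct.lift ((LinearMap.mul ℝ ℝ).compl₁₂ (lcoeff ℝ p.1 ∘ₗ (Harm d).subtype)
    (lcoeff ℝ p.2 ∘ₗ (Harm d).subtype))

lemma tensorCoeff_tmul (p : (Fin d →₀ ℕ) × (Fin d →₀ ℕ)) (u v : Harm d) :
    tensorCoeff p (u ⊗ₜ v) = coeff p.1 (u : Poly d) * coeff p.2 (v : Poly d) := rfl

/-- A general tensor carries no chosen finite support. `HasSum` is additive, so expansions checked
on pure tensors pass to sums. -/
lemma hasSum_of_support_tmul (u v : Harm d) {F : (Fin d →₀ ℕ) × (Fin d →₀ ℕ) → ℝ}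
    (hF : ∀ p, tensorCoeff p (u ⊗ₜ v) = 0 → F p = 0) :
    HasSum F (∑ β ∈ (u : Poly d).support, ∑ γ ∈ (v : Poly d).support, F (β, γ)) := by
  rw [← Finset.sum_product']
  refine hasSum_sum_of_ne_finset_zero fun p hp => hF p ?_
  rw [tensorCoeff_tmul]
  by_contra h
  exact hp (Finset.mem_product.2 ⟨mem_support_iff.2 (left_ne_zero_of_mul h),
    mem_support_iff.2 (right_ne_zero_of_mul h)⟩)

lemma hasSum_contraction (a : EuclideanSpace ℝ (Fin d)) (r : ℝ) (b : EuclideanSpace ℝ (Fin d))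
    (s : ℝ) (t : Harm d ⊗[ℝ] Harm d) :
    HasSum (fun p => fischerWeight d p.1.degree * fischerWeight d p.2.degree *
      contractionCoeff a r b s p.1 p.2 * tensorCoeff p t) (contraction a r b s t) := by
  induction t using TensorProduct.induction_on with
  | zero => simp
  | add t t' ht ht' => simpa only [map_add, mul_add] using ht.add ht'
  | tmul u v =>
    convert hasSum_of_support_tmul u v _ using 1
    · rw [contraction_tmul, weightedEval_apply, LinearMap.sum_apply]
      refine Finset.sum_congr rfl fun β _ => ?_
      rw [LinearMap.smul_apply, LinearMap.smul_apply, weightedEval_apply, Finset.smul_sum,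
        Finset.smul_sum]
      refine Finset.sum_congr rfl fun γ _ => ?_
      simp only [tensorCoeff_tmul, smul_eq_mul]
      ring
    · intro p hp
      rw [hp, mul_zero]

end coefficients

/-! ### Cauchy–Schwarz bound and extension by density. -/

section hilbert

variable (d : ℕ) [hd : Fact (3 ≤ d)]

/-- The identification of `Harm_d ⊗ Harm_d` with its copy that carries an inner product. -/
def toPreHilbertSquare : (Harm d ⊗[ℝ] Harm d) ≃ₗ[ℝ] (PreHilbert d ⊗[ℝ] PreHilbert d) :=
  TensorProduct.congr (toPreHilbert d) (toPreHilbert d)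

variable {d}

lemma inner_toPreHilbertSquare_tmul (u v u' v' : Harm d) :
    inner ℝ (toPreHilbertSquare d (u ⊗ₜ v)) (toPreHilbertSquare d (u' ⊗ₜ v')) =
      fischerForm d u u' * fischerForm d v v' := by
  rw [toPreHilbertSquare, TensorProduct.congr_tmul, TensorProduct.congr_tmul,
    TensorProduct.inner_tmul, inner_toPreHilbert, inner_toPreHilbert, harmForm_eq]
  rfl

lemma hasSum_inner (t t' : Harm d ⊗[ℝ] Harm d) :
    HasSum (fun p : (Fin d →₀ ℕ) × (Fin d →₀ ℕ) =>
      (multiFactorial p.1 * multiFactorial p.2) *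
        (fischerWeight d p.1.degree * fischerWeight d p.2.degree) *
        (tensorCoeff p t * tensorCoeff p t'))
      (inner ℝ (toPreHilbertSquare d t) (toPreHilbertSquare d t')) := by
  induction t using TensorProduct.induction_on with
  | zero => simp
  | add t₁ t₂ h₁ h₂ =>
    simpa only [map_add, inner_add_left, add_mul, mul_add] using h₁.add h₂
  | tmul u v =>
    induction t' using TensorProduct.induction_on with
    | zero => simp
    | add t₁ t₂ h₁ h₂ =>
      simpa only [map_add, inner_add_right, mul_add] using h₁.add h₂
    | tmul u' v' =>
      convert hasSum_of_support_tmul u v _ using 1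
      · rw [inner_toPreHilbertSquare_tmul, fischerForm, wForm_apply, wForm_apply,
          Finset.sum_mul_sum]
        refine Finset.sum_congr rfl fun β _ => Finset.sum_congr rfl fun γ _ => ?_
        simp only [tensorCoeff_tmul, multiFactorial]
        ring
      · intro p hp
        rw [hp, zero_mul, mul_zero]

variable {a b : EuclideanSpace ℝ (Fin d)} {r s : ℝ}

lemma exists_contraction_le (hr : 0 < r) (hs : 0 < s) (hrs : r + s < ‖a - b‖) :
    ∃ K : ℝ, ∀ t, ‖contraction a r b s t‖ ≤ K * ‖toPreHilbertSquare d t‖ := by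
  obtain ⟨K, hK⟩ := exists_sum_contractionCoeffSq_le hd.out hr hs hrs
  have hK0 : 0 ≤ K := by simpa using hK ∅
  refine ⟨√K, fun t => ?_⟩
  rw [Real.norm_eq_abs]
  refine abs_le_of_sq_le_sq ?_ (by positivity)
  rw [mul_pow, Real.sq_sqrt hK0, ← real_inner_self_eq_norm_sq]
  have hsum := hasSum_inner t t
  -- It suffices to bound the squares of the partial sums over finite sets `S`.
  refine le_of_tendsto ((hasSum_contraction a r b s t).pow 2) (Filter.Eventually.of_forall
    fun S => ?_)
  have hnn : ∀ p : (Fin d →₀ ℕ) × (Fin d →₀ ℕ), 0 ≤ (multiFactorial p.1 * multiFactorial p.2) *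
      (fischerWeight d p.1.degree * fischerWeight d p.2.degree) *
      (tensorCoeff p t * tensorCoeff p t) := fun p => by
    have h1 := fischerWeight_pos hd.out p.1.degree
    have h2 := fischerWeight_pos hd.out p.2.degree
    have h3 := multiFactorial_pos p.1
    have h4 := multiFactorial_pos p.2
    have h5 := mul_self_nonneg (tensorCoeff p t)
    positivity
  -- Cauchy–Schwarz: each squared term of the contraction is the squared coefficient with weight
  -- `1/(β! γ!)` times the matching term of `‖t‖²`.
  refine (Finset.sum_sq_le_sum_mul_sum_of_sq_le_mul S
    (f := contractionCoeffSq a r b s) (g := fun p => (multiFactorial p.1 * multiFactorial p.2) *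
      (fischerWeight d p.1.degree * fischerWeight d p.2.degree) *
      (tensorCoeff p t * tensorCoeff p t))
    (fun p _ => contractionCoeffSq_nonneg hd.out p) (fun p _ => hnn p) fun p _ => ?_).trans ?_
  · have h3 := (multiFactorial_pos p.1).ne'
    have h4 := (multiFactorial_pos p.2).ne'
    refine le_of_eq ?_
    rw [contractionCoeffSq]
    field_simp
  · exact mul_le_mul (hK S) (sum_le_hasSum S (fun p _ => hnn p) hsum)
      (Finset.sum_nonneg fun p _ => hnn p) hK0

variable (d) in
/-- The isometric inclusion of the algebraic tensor square into `ℋ ⊗̂ ℋ`. -/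
def preHilbertSquareIncl : (PreHilbert d ⊗[ℝ] PreHilbert d) →ₗᵢ[ℝ] HilbertSquare d :=
  UniformSpace.Completion.toComplₗᵢ.comp
    (TensorProduct.mapIsometry UniformSpace.Completion.toComplₗᵢ
      UniformSpace.Completion.toComplₗᵢ)

lemma preHilbertSquareIncl_toPreHilbertSquare (t : Harm d ⊗[ℝ] Harm d) :
    preHilbertSquareIncl d (toPreHilbertSquare d t) = tensorIncl d t := by
  induction t using TensorProduct.induction_on with
  | zero => simp
  | add t t' h h' => simp only [map_add, h, h']
  | tmul u v => rfl

/-- The closure of the range is a subspace. It contains every pure tensor, by density in both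
factors and continuity of `⊗ₜ`, hence everything. -/
lemma denseRange_map_coe {E : Type*} [NormedAddCommGroup E] [InnerProductSpace ℝ E] :
    DenseRange (TensorProduct.mapIsometry (UniformSpace.Completion.toComplₗᵢ (𝕜 := ℝ) (E := E))
      (UniformSpace.Completion.toComplₗᵢ (𝕜 := ℝ) (E := E))) := by
  set f := TensorProduct.mapIsometry (UniformSpace.Completion.toComplₗᵢ (𝕜 := ℝ) (E := E))
      (UniformSpace.Completion.toComplₗᵢ (𝕜 := ℝ) (E := E)) with hf
  set S := (LinearMap.range f.toLinearMap).topologicalClosure with hS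
  have h : ∀ x y : UniformSpace.Completion E, x ⊗ₜ[ℝ] y ∈ S := by
    intro x y
    have hcl : IsClosed {p : UniformSpace.Completion E × UniformSpace.Completion E |
        p.1 ⊗ₜ[ℝ] p.2 ∈ S} :=
      (Submodule.isClosed_topologicalClosure _).preimage TensorProduct.continuous_tmul
    refine UniformSpace.Completion.induction_on₂ x y hcl fun u v => ?_
    exact Submodule.le_topologicalClosure _ ⟨u ⊗ₜ v, rfl⟩
  intro z
  change z ∈ S
  induction z using TensorProduct.induction_on with
  | zero => exact S.zero_mem
  | add z z' hz hz' => exact S.add_mem hz hz'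
  | tmul x y => exact h x y

lemma denseRange_preHilbertSquareIncl : DenseRange (preHilbertSquareIncl d) :=
  UniformSpace.Completion.denseRange_coe.comp denseRange_map_coe
    (UniformSpace.Completion.continuous_coe _)

/-- The bound makes `C` continuous for the norm of the algebraic tensor square, whose inclusion is
isometric with dense range. -/
lemma existsUnique_extension {C : (Harm d ⊗[ℝ] Harm d) →ₗ[ℝ] ℝ} {K : ℝ}
    (hC : ∀ t, ‖C t‖ ≤ K * ‖toPreHilbertSquare d t‖) :
    ∃! Chat : HilbertSquare d →L[ℝ] ℝ, ∀ t, Chat (tensorIncl d t) = C t := by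
  let f : (PreHilbert d ⊗[ℝ] PreHilbert d) →L[ℝ] ℝ :=
    (C ∘ₗ (toPreHilbertSquare d).symm.toLinearMap).mkContinuous K fun x => by
      simpa using hC ((toPreHilbertSquare d).symm x)
  let e := (preHilbertSquareIncl d).toContinuousLinearMap
  have he : DenseRange e := denseRange_preHilbertSquareIncl
  have hu : IsUniformInducing e := (preHilbertSquareIncl d).isometry.isUniformInducing
  refine ⟨f.extend e, fun t => ?_, fun g hg => ?_⟩
  · rw [← preHilbertSquareIncl_toPreHilbertSquare]
    refine (f.extend_eq he hu _).trans ?_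
    simp [f]
  · refine (f.extend_unique he hu g ?_).symm
    ext1 x
    obtain ⟨t, rfl⟩ := (toPreHilbertSquare d).surjective x
    simp [f, e, preHilbertSquareIncl_toPreHilbertSquare, hg]

end hilbert

end

end HarmPoly

theorem mainTheorem4 (d : ℕ) [Fact (3 ≤ d)] (a b : EuclideanSpace ℝ (Fin d)) (r s : ℝ)
    (ha : a ∈ Metric.ball (0 : EuclideanSpace ℝ (Fin d)) 1)
    (hb : b ∈ Metric.ball (0 : EuclideanSpace ℝ (Fin d)) 1)
    (hr : r ∈ Set.Ioo (0 : ℝ) 1) (hs : s ∈ Set.Ioo (0 : ℝ) 1)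
    (hdisj : Disjoint (Metric.closedBall a r) (Metric.closedBall b s))
    (har : Metric.ball a r ⊆ Metric.ball (0 : EuclideanSpace ℝ (Fin d)) 1)
    (hbs : Metric.ball b s ⊆ Metric.ball (0 : EuclideanSpace ℝ (Fin d)) 1) :
    (∃! C : (HarmPoly.Harm d ⊗[ℝ] HarmPoly.Harm d) →ₗ[ℝ] ℝ,
      HarmPoly.IsContraction a r b s C) ∧
    ∀ C : (HarmPoly.Harm d ⊗[ℝ] HarmPoly.Harm d) →ₗ[ℝ] ℝ, HarmPoly.IsContraction a r b s C →
      ∃! Chat : HarmPoly.HilbertSquare d →L[ℝ] ℝ,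
        ∀ t : HarmPoly.Harm d ⊗[ℝ] HarmPoly.Harm d, Chat (HarmPoly.tensorIncl d t) = C t := by
  have hd : 3 ≤ d := Fact.out
  -- The geometric hypothesis enters here: it makes the ratio of the dominating geometric series
  -- less than 1.
  have hrs : r + s < ‖a - b‖ := by
    rw [← dist_eq_norm]
    exact (disjoint_closedBall_closedBall_iff hr.1.le hs.1.le).1 hdisj
  have hab : a ≠ b := sub_ne_zero.1 (norm_pos_iff.1 (by linarith [hr.1, hs.1]))
  have hC := HarmPoly.isContraction_contraction hd hr.1 hs.1 hab
  refine ⟨⟨_, hC, fun C' hC' => HarmPoly.isContraction_unique hd hC' hC⟩, fun C' hC' => ?_⟩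
  rw [HarmPoly.isContraction_unique hd hC' hC]
  obtain ⟨K, hK⟩ := HarmPoly.exists_contraction_le hr.1 hs.1 hrs
  exact HarmPoly.existsUnique_extension hK
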